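/- **Proposition 5.18.** By a curve we mean a noetherian scheme of pure dimension $1$ (every irreducible component has dimension $1$ and there are no embedded points). Let $\mathcal K_X$ be the sheaf of total quotient rings of a curve $X$. A *generalized divisor* $D$ on $X$ is a coherent $\mathcal O_X$-submodule $\mathcal I_D\subseteq\mathcal K_X$ with $(\mathcal I_D)_\eta=\mathcal K_{X,\eta}$ at every generic point $\eta$ of $X$. It is *effective* if $\mathcal I_D\subseteq\mathcal O_X$ and *Cartier* if $\mathcal I_D$ is invertible. The sum $D+E$ is defined by $\mathcal I_D\cdot\mathcal I_E$ (so $n\cdot D$ is defined by $\mathcal I_D^{\,n}$, with $\mathcal I_D^{\,0}=\mathcal O_X$), and $-D$ is defined by $\mathcal I_D^{-1}=\{f\in\mathcal K_X : f\,\mathcal I_D\subseteq\mathcal O_X\}$. Let $\pi:X\to Y$ be a finite flat morphism of degree $n$ between curves, i.e. $\pi_*\mathcal O_X$ is locally free of rank $n$ over $\mathcal O_Y$. * If $E$ is an effective generalized divisor on $Y$, then $\pi^*(E)$ is the effective generalized divisor on $X$ with ideal sheaf $\pi^{-1}(\mathcal I_E)\cdot\mathcal O_X$. For an arbitrary generalized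 divisor $D$ on $Y$, $\pi^*(D):=\pi^*(E)-\pi^*(F)$, where $D=E-F$ with $E,F$ effective and $F$ Cartier. * If $E$ is an effective generalized divisor on $X$, then $\pi_*(E)$ is the effective generalized divisor on $Y$ whose ideal sheaf is the $0$-th Fitting ideal $\mathrm{Fitt}_0(\pi_*(\mathcal O_X/\mathcal I_E))$. For an arbitrary generalized divisor $D$ on $X$, $\pi_*(D):=\pi_*(E)-\pi_*(F)$, where $D=E-F$ with $E,F$ effective and $F$ Cartier. Then for every generalized divisor $D$ on $Y$, the inverse image $\pi^*(D)$ exists and is independent of the choice of decomposition of $D$, the direct image of $\pi^*(D)$ exists and is independent of the choice of decomposition of $\pi^*(D)$, and $$\pi_*(\pi^*(D)) = n\cdot D .$$ -/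

import Mathlib

open AlgebraicGeometry CategoryTheory TopologicalSpace

universe u

/-- A *curve*: a noetherian scheme of pure dimension one. Purity means that every irreducible
component has dimension one and that there are no embedded points, i.e. every associated prime of
every local ring is minimal. -/
class IsCurve (X : Scheme.{u}) : Prop extends IsNoetherian X where
  dim_component : ∀ Z ∈ irreducibleComponents X, topologicalKrullDim Z = 1
  no_embedded : ∀ x : X, ∀ p ∈ associatedPrimes (X.presheaf.stalk x) (X.presheaf.stalk x),
    p ∈ minimalPrimes (X.presheaf.stalk x)

section FittingIdeal

/-- The `0`-th Fitting ideal of a (finitely generated) `R`-module `M`: the ideal generated by the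
determinants of all the `r × r` matrices whose rows are relations among generators `m₁, …, m_r`
of `M`. Any single system of generators, together with any generating set of its relations,
already yields the same ideal (the ideal of maximal minors of a presentation matrix). For `r = 0`
the determinant is `1`. -/
def fittingIdeal (R : Type*) [CommRing R] (M : Type*) [AddCommGroup M] [Module R M] : Ideal R :=
  Ideal.span {d | ∃ (r : ℕ) (m : Fin r → M) (A : Matrix (Fin r) (Fin r) R),
    Submodule.span R (Set.range m) = ⊤ ∧ (∀ i, ∑ j, A i j • m j = 0) ∧ d = A.det}

end FittingIdeal

section TotalQuotients

/-- The stalk at `x` of the sheaf `𝒦_X` of total quotient rings of a noetherian scheme: the total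
ring of fractions of `𝒪_{X,x}`. -/
abbrev TotalQuotient (X : Scheme.{u}) (x : X) : Type u := FractionRing (X.presheaf.stalk x)

/-- The sections of `𝒦_X` over an open `U`: the families of elements of the stalks that are, locally
on `U`, fractions `a / b` of sections of `𝒪_X` with `b` a nonzerodivisor at every point. -/
def IsTotalQuotientSection {X : Scheme.{u}} {U : X.Opens} (s : ∀ y : U, TotalQuotient X y) : Prop :=
  ∀ y : U, ∃ (V : X.Opens) (_ : y.1 ∈ V) (hVU : V ≤ U) (a b : Γ(X, V)),
    ∀ (z : X) (hz : z ∈ V),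
      X.presheaf.germ V z hz b ∈ nonZeroDivisors (X.presheaf.stalk z) ∧
      algebraMap _ (TotalQuotient X z) (X.presheaf.germ V z hz b) * s ⟨z, hVU hz⟩ =
        algebraMap _ (TotalQuotient X z) (X.presheaf.germ V z hz a)

lemma IsTotalQuotientSection.one {X : Scheme.{u}} (U : X.Opens) :
    IsTotalQuotientSection (U := U) (fun _ => 1) := by
  intro y
  refine ⟨U, y.2, le_rfl, 1, 1, fun z hz => ⟨?_, ?_⟩⟩
  · simp only [map_one]; exact one_mem _
  · simp

lemma IsTotalQuotientSection.mul_restrict {X : Scheme.{u}} {U U' : X.Opens}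
    {s : ∀ y : U, TotalQuotient X y} {s' : ∀ y : U', TotalQuotient X y}
    (hs : IsTotalQuotientSection s) (hs' : IsTotalQuotientSection s') :
    IsTotalQuotientSection (U := U ⊓ U') (fun y => s ⟨y, y.2.1⟩ * s' ⟨y, y.2.2⟩) := by
  intro y
  obtain ⟨V, hyV, hVU, a, b, h⟩ := hs ⟨y, y.2.1⟩
  obtain ⟨V', hyV', hVU', a', b', h'⟩ := hs' ⟨y, y.2.2⟩
  refine ⟨V ⊓ V', ⟨hyV, hyV'⟩, inf_le_inf hVU hVU',
    X.presheaf.map (homOfLE inf_le_left).op a * X.presheaf.map (homOfLE inf_le_right).op a',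
    X.presheaf.map (homOfLE inf_le_left).op b * X.presheaf.map (homOfLE inf_le_right).op b',
    fun z hz => ?_⟩
  obtain ⟨h1, h2⟩ := h z hz.1
  obtain ⟨h1', h2'⟩ := h' z hz.2
  simp only [map_mul, TopCat.Presheaf.germ_res_apply]
  refine ⟨mul_mem h1 h1', ?_⟩
  rw [← h2, ← h2']
  ring

end TotalQuotients

/-- A *generalized divisor* on `X`: a coherent `𝒪_X`-submodule `𝓘` of `𝒦_X` (a fractional ideal)
with `𝓘_η = 𝒦_{X,η}` at every generic point `η`. The subsheaf is recorded by its stalks: a family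
of submodules of the stalks of `𝒦_X` is the family of stalks of a submodule of finite type
(equivalently, a coherent one, as `X` is noetherian) exactly when it is locally generated by
finitely many sections of `𝒦_X`. -/
@[ext]
structure GeneralizedDivisor (X : Scheme.{u}) where
  /-- The stalks of the fractional ideal. -/
  stalk : ∀ x : X, Submodule (X.presheaf.stalk x) (TotalQuotient X x)
  coherent : ∀ x : X, ∃ (U : X.Opens) (_ : x ∈ U) (ι : Type) (_ : Finite ι)
    (s : ι → ∀ y : U, TotalQuotient X y), (∀ i, IsTotalQuotientSection (s i)) ∧
      ∀ y : U, stalk y = Submodule.span _ (Set.range fun i => s i y)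
  nondegenerate : ∀ η ∈ genericPoints X, stalk η = ⊤

namespace GeneralizedDivisor

variable {X Y : Scheme.{u}}

/-- The zero divisor, with fractional ideal `𝒪_X`. -/
noncomputable instance : Zero (GeneralizedDivisor X) where
  zero :=
    { stalk := fun _ => 1
      coherent := fun x => ⟨⊤, trivial, Unit, inferInstance, fun _ _ => 1,
        fun _ => IsTotalQuotientSection.one _, fun y => by
          rw [Set.range_const, Submodule.one_eq_span]⟩
      nondegenerate := fun η hη => by
        -- At a generic point the local ring has a single prime, so nonzerodivisors are units.
        have hmin : ∀ p : Ideal (X.presheaf.stalk η), p.IsPrime →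
            p = IsLocalRing.maximalIdeal (X.presheaf.stalk η) := by
          intro p hp
          have h1 : X.fromSpecStalk η ⟨p, hp⟩ ⤳ η := by
            have := (Scheme.range_fromSpecStalk (X := X) (x := η)).le ⟨⟨p, hp⟩, rfl⟩
            exact this
          have h2 : X.fromSpecStalk η ⟨p, hp⟩ = η := by
            have hη' : closure {η} ∈ irreducibleComponents X := hη
            have hle : closure {η} ≤ closure {X.fromSpecStalk η ⟨p, hp⟩} :=
              specializes_iff_closure_subset.1 h1
            have := hη'.2 (isIrreducible_singleton.closure) hle
            exact (h1.antisymm (specializes_iff_closure_subset.2 this)).eq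
          have h3 : X.fromSpecStalk η ⟨p, hp⟩ =
              X.fromSpecStalk η (IsLocalRing.closedPoint (X.presheaf.stalk η)) := by
            rw [h2, Scheme.fromSpecStalk_closedPoint]
          have h4 := (X.fromSpecStalk η).isEmbedding.injective h3
          exact congrArg PrimeSpectrum.asIdeal h4
        have hunit : ∀ b ∈ nonZeroDivisors (X.presheaf.stalk η), IsUnit b := by
          intro b hb
          by_contra hbu
          have hbm : b ∈ nilradical (X.presheaf.stalk η) := by
            rw [nilradical_eq_sInf, Submodule.mem_sInf]
            intro p hp
            rw [hmin p hp]
            exact hbu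
          obtain ⟨k, hk⟩ := hbm
          have : (b ^ k) ∈ nonZeroDivisors (X.presheaf.stalk η) := pow_mem hb k
          rw [hk] at this
          exact zero_notMem_nonZeroDivisors this
        rw [eq_top_iff]
        rintro z -
        obtain ⟨⟨a, b⟩, rfl⟩ := IsLocalization.mk'_surjective
          (nonZeroDivisors (X.presheaf.stalk η)) z
        obtain ⟨c, hc⟩ := hunit b.1 b.2
        refine Submodule.mem_one.2 ⟨a * ↑c⁻¹, ?_⟩
        rw [IsLocalization.eq_mk'_iff_mul_eq, ← map_mul, ← hc, mul_assoc, Units.inv_mul, mul_one] }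

/-- The sum of generalized divisors, with fractional ideal the product of fractional ideals. -/
noncomputable instance : Add (GeneralizedDivisor X) where
  add D E :=
    { stalk := fun x => D.stalk x * E.stalk x
      coherent := fun x => by
        obtain ⟨U, hx, ι, _, s, hs, h⟩ := D.coherent x
        obtain ⟨U', hx', ι', _, s', hs', h'⟩ := E.coherent x
        refine ⟨U ⊓ U', ⟨hx, hx'⟩, ι × ι', inferInstance,
          fun i y => s i.1 ⟨y, y.2.1⟩ * s' i.2 ⟨y, y.2.2⟩,
          fun i => (hs i.1).mul_restrict (hs' i.2), fun y => ?_⟩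
        rw [h ⟨y, y.2.1⟩, h' ⟨y, y.2.2⟩, Submodule.span_mul_span]
        congr 1
        ext z
        simp only [Set.mem_mul, Set.mem_range, Prod.exists]
        constructor
        · rintro ⟨_, ⟨i, rfl⟩, _, ⟨j, rfl⟩, rfl⟩
          exact ⟨i, j, rfl⟩
        · rintro ⟨i, j, rfl⟩
          exact ⟨_, ⟨i, rfl⟩, _, ⟨j, rfl⟩, rfl⟩
      nondegenerate := fun η hη => by
        rw [D.nondegenerate η hη, E.nondegenerate η hη, eq_top_iff]
        intro z _
        rw [← one_mul z]
        exact Submodule.mul_mem_mul trivial trivial }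

lemma zero_stalk (x : X) : (0 : GeneralizedDivisor X).stalk x = 1 := rfl

lemma add_stalk (D E : GeneralizedDivisor X) (x : X) :
    (D + E).stalk x = D.stalk x * E.stalk x := rfl

/-- Generalized divisors form a commutative monoid; in particular `n • D = D + ⋯ + D`. -/
noncomputable instance : AddCommMonoid (GeneralizedDivisor X) where
  add_assoc D E F := by
    ext x : 2
    simp only [add_stalk, mul_assoc]
  zero_add D := by
    ext x : 2
    simp only [add_stalk, zero_stalk, one_mul]
  add_zero D := by
    ext x : 2
    simp only [add_stalk, zero_stalk, mul_one]
  add_comm D E := by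
    ext x : 2
    simp only [add_stalk, mul_comm]
  nsmul := nsmulRec

/-- `D` is *effective* if its fractional ideal is contained in `𝒪_X`. -/
def IsEffective (D : GeneralizedDivisor X) : Prop := ∀ x : X, D.stalk x ≤ 1

/-- `D` is *Cartier* if its fractional ideal is invertible, i.e. locally generated by a regular
meromorphic section. -/
def IsCartier (D : GeneralizedDivisor X) : Prop :=
  ∀ x : X, ∃ f : (TotalQuotient X x)ˣ, D.stalk x = Submodule.span _ {(f : TotalQuotient X x)}

/-- `D = E - F`, i.e. `D = E + (-F)`: the fractional ideal of `-F` is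
`𝓘_F⁻¹ = {f ∈ 𝒦_X | 𝓘_F · f ⊆ 𝒪_X}`, and the fractional ideal of `D` is `𝓘_E · 𝓘_F⁻¹`. -/
def IsDifference (D E F : GeneralizedDivisor X) : Prop :=
  ∀ x : X, D.stalk x = E.stalk x * (1 / F.stalk x)

/-- The stalk at `x` of the ideal sheaf `𝓘 ∩ 𝒪_X`; it is the stalk of the ideal sheaf of `D`
when `D` is effective. -/
noncomputable def idealStalk (D : GeneralizedDivisor X) (x : X) : Ideal (X.presheaf.stalk x) :=
  (D.stalk x).comap (Algebra.linearMap (X.presheaf.stalk x) (TotalQuotient X x))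

/-- The sections over `U` of the ideal sheaf of an effective divisor `D`. -/
noncomputable def idealSections (D : GeneralizedDivisor X) (U : X.Opens) : Ideal Γ(X, U) :=
  ⨅ x : U, (D.idealStalk x).comap (X.presheaf.germ U x x.2).hom

/-- For an effective divisor `E` on `Y`: `E'` is the inverse image `π^*(E)`, the effective divisor
on `X` with ideal sheaf `π⁻¹(𝓘) · 𝒪_X`, where `𝓘` is the ideal sheaf of `E`. -/
def IsEffectiveInverseImage (π : X ⟶ Y) (E : GeneralizedDivisor Y) (E' : GeneralizedDivisor X) :
    Prop :=
  ∀ x : X, E'.stalk x = IsLocalization.coeSubmodule (TotalQuotient X x)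
    ((E.idealStalk (π x)).map (π.stalkMap x).hom)

/-- The `0`-th Fitting ideal of `Γ(V, π_*(𝒪_X / 𝓘)) = Γ(π⁻¹V, 𝒪_X) / Γ(π⁻¹V, 𝓘)` as a module over
`Γ(V, 𝒪_Y)`, where `𝓘` is the ideal sheaf of the effective divisor `E`, `π` is an affine morphism
and `V` is an affine open of `Y`. -/
noncomputable def pushforwardFitting (π : X ⟶ Y) (E : GeneralizedDivisor X) (V : Y.Opens) :
    Ideal Γ(Y, V) :=
  letI : Module Γ(Y, V) (Γ(X, π ⁻¹ᵁ V) ⧸ E.idealSections (π ⁻¹ᵁ V)) :=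
    Module.compHom _ (π.app V).hom
  fittingIdeal Γ(Y, V) (Γ(X, π ⁻¹ᵁ V) ⧸ E.idealSections (π ⁻¹ᵁ V))

/-- For an effective divisor `E` on `X`: `E'` is the direct image `π_*(E)`, the effective divisor
on `Y` whose ideal sheaf is the `0`-th Fitting ideal of `π_*(𝒪_X / 𝓘)`, where `𝓘` is the ideal
sheaf of `E`. -/
def IsEffectiveDirectImage (π : X ⟶ Y) (E : GeneralizedDivisor X) (E' : GeneralizedDivisor Y) :
    Prop :=
  ∀ (V : Y.Opens), IsAffineOpen V → ∀ (y : Y) (hy : y ∈ V),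
    E'.stalk y = IsLocalization.coeSubmodule (TotalQuotient Y y)
      ((pushforwardFitting π E V).map (Y.presheaf.germ V y hy).hom)

/-- `D'` is an inverse image `π^*(D)`: for some `D = E - F` with `E`, `F` effective and `F`
Cartier, `D' = π^*(E) - π^*(F)`. -/
def IsInverseImage (π : X ⟶ Y) (D : GeneralizedDivisor Y) (D' : GeneralizedDivisor X) : Prop :=
  ∃ E F : GeneralizedDivisor Y, E.IsEffective ∧ F.IsEffective ∧ F.IsCartier ∧ D.IsDifference E F ∧
    ∃ E' F' : GeneralizedDivisor X, IsEffectiveInverseImage π E E' ∧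
      IsEffectiveInverseImage π F F' ∧ D'.IsDifference E' F'

/-- `D'` is a direct image `π_*(D)`: for some `D = E - F` with `E`, `F` effective and `F` Cartier,
`D' = π_*(E) - π_*(F)`. -/
def IsDirectImage (π : X ⟶ Y) (D : GeneralizedDivisor X) (D' : GeneralizedDivisor Y) : Prop :=
  ∃ E F : GeneralizedDivisor X, E.IsEffective ∧ F.IsEffective ∧ F.IsCartier ∧ D.IsDifference E F ∧
    ∃ E' F' : GeneralizedDivisor Y, IsEffectiveDirectImage π E E' ∧
      IsEffectiveDirectImage π F F' ∧ D'.IsDifference E' F'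

end GeneralizedDivisor

/-! The inverse image is extension of fractional ideals. Flatness preserves nonzerodivisors, so
`totalQuotientMap` exists and 𝓘_D generates a fractional ideal on X (`pullback`). Extension commutes
with products and with inverses of invertible ideals, so π^*(E) - π^*(F) is this ideal for every
decomposition D = E - F. Decompositions exist because D fails to be effective at only finitely many
closed points, where denominators can be cleared (`exists_isCartier_add_isEffective`).

For the direct image, let π^*(D) = E - F be any decomposition on X, not necessarily pulled back from
Y. Fix y, put A = 𝒪_{Y,y} and let B be the stalk of π_*𝒪_X at y, a free A-algebra of rank n. Choose
a denominator g of D at y, so that J = g𝓘_D is an ideal of A. An invertible ideal is principal near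
the finite fibre (`IsCartier.exists_generator_fiber`), say 𝓘_F B = fB, and the decomposition becomes
g𝓘_E = fJB.

Over a free algebra, Fitt(B/I) is generated by the determinants of n-tuples from I. Hence Fitt(B/fI)
= N(f) Fitt(B/I) and Fitt(B/JB) = J^n. Computing the Fitting ideal of B/g𝓘_E = B/fJB in two ways
gives g^n Fitt(B/𝓘_E) = N(f) J^n = N(f) g^n 𝓘_D^n. Moreover N(f) is a nonzerodivisor generating
Fitt(B/fB). Cancelling g^n and dividing by N(f) leaves 𝓘_D^n, whatever E and F were
(`exists_coeSubmodule_pushforwardFitting_eq`). -/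

/-! ### Fitting ideals: generators, localization, quotients of free modules. -/

section Fitting

/-- The ideal generated by the determinants of square matrices of relations among `e`. -/
def relationDetIdeal (R : Type*) [CommRing R] {M : Type*} [AddCommGroup M] [Module R M]
    {ι : Type*} [Fintype ι] [DecidableEq ι] (e : ι → M) : Ideal R :=
  Ideal.span {d | ∃ A : Matrix ι ι R, (∀ i, ∑ j, A i j • e j = 0) ∧ d = A.det}

variable {R : Type*} [CommRing R] {M : Type*} [AddCommGroup M] [Module R M]

lemma relationDetIdeal_comp_le {ι κ : Type*} [Fintype ι] [DecidableEq ι] [Fintype κ]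
    [DecidableEq κ] (σ : κ ≃ ι) (e : ι → M) :
    relationDetIdeal R e ≤ relationDetIdeal R (e ∘ σ) := by
  refine Ideal.span_le.2 ?_
  rintro _ ⟨A, hA, rfl⟩
  refine Ideal.subset_span ⟨A.submatrix σ σ, fun i => ?_, (Matrix.det_submatrix_equiv_self σ A).symm⟩
  rw [← hA (σ i), ← σ.sum_comp]
  rfl

lemma relationDetIdeal_comp_equiv {ι κ : Type*} [Fintype ι] [DecidableEq ι] [Fintype κ]
    [DecidableEq κ] (σ : κ ≃ ι) (e : ι → M) :
    relationDetIdeal R (e ∘ σ) = relationDetIdeal R e := by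
  refine le_antisymm ?_ (relationDetIdeal_comp_le σ e)
  have := relationDetIdeal_comp_le (R := R) σ.symm (e ∘ σ)
  rwa [Function.comp_assoc, σ.self_comp_symm, Function.comp_id] at this

/-- Write the redundant generator as `∑ c j • e j`. Adding `c j` times column 0 to the column of `e
j` preserves the determinant and turns the rest of each row into a relation among `e`; expansion
along column 0 then gives one inclusion. For the other, border a relation matrix of `e` by the row
`(1, -c)`, which has the same determinant. -/
lemma relationDetIdeal_cons {k : ℕ} (e : Fin k → M) (m : M)
    (hm : m ∈ Submodule.span R (Set.range e)) :
    relationDetIdeal R (Fin.cons m e : Fin (k + 1) → M) = relationDetIdeal R e := by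
  obtain ⟨c, rfl⟩ := (Submodule.mem_span_range_iff_exists_fun R).1 hm
  refine le_antisymm (Ideal.span_le.2 ?_) (Ideal.span_le.2 ?_)
  · rintro _ ⟨A, hA, rfl⟩
    let A' : Matrix (Fin (k + 1)) (Fin (k + 1)) R :=
      Matrix.of fun i j => A i j + (Fin.cons 0 c : Fin (k + 1) → R) j * A i 0
    have hdet : A'.det = A.det := by
      rw [← Matrix.det_transpose A', ← Matrix.det_transpose A]
      exact Matrix.det_eq_of_forall_row_eq_smul_add_const (Fin.cons 0 c) 0 (by simp)
        (fun i j => rfl)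
    rw [← hdet, Matrix.det_succ_column_zero]
    refine Ideal.sum_mem _ fun i _ => Ideal.mul_mem_left _ _ (Ideal.subset_span ⟨_, fun l => ?_, rfl⟩)
    have := hA (i.succAbove l)
    rw [Fin.sum_univ_succ] at this
    simp only [Fin.cons_zero, Fin.cons_succ] at this
    rw [← this]
    simp only [Matrix.submatrix_apply, A', Matrix.of_apply, Fin.cons_succ, add_smul,
      Finset.sum_add_distrib, Finset.smul_sum, smul_smul, mul_comm]
    rw [add_comm]
  · rintro _ ⟨A, hA, rfl⟩
    let A' : Matrix (Fin (k + 1)) (Fin (k + 1)) R :=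
      Fin.cons (Fin.cons 1 (-c)) (fun i => Fin.cons 0 (A i))
    refine Ideal.subset_span ⟨A', fun i => ?_, ?_⟩
    · refine Fin.cases ?_ (fun i => ?_) i
      · simp [A', Fin.sum_univ_succ]
      · simp [A', Fin.sum_univ_succ, hA]
    · rw [Matrix.det_succ_column_zero, Fin.sum_univ_succ]
      simp only [A', Fin.cons_zero, Fin.cons_succ]
      simp only [Fin.val_zero, pow_zero, mul_one, Fin.succAbove_zero, one_mul, mul_zero,
        zero_mul, Finset.sum_const_zero, add_zero]
      rfl

lemma relationDetIdeal_append {k r : ℕ} (e : Fin k → M) (m : Fin r → M)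
    (he : Submodule.span R (Set.range e) = ⊤) :
    relationDetIdeal R (Fin.append m e) = relationDetIdeal R e := by
  induction r with
  | zero =>
    rw [← relationDetIdeal_comp_equiv (finCongr (Nat.zero_add k)) e]
    congr 1
    ext i
    rw [Subsingleton.elim m Fin.elim0, Fin.elim0_append]
    rfl
  | succ r ih =>
    have h := Fin.append_cons (m 0) (Fin.tail m) e
    rw [Fin.cons_self_tail] at h
    rw [h]
    have hcast := relationDetIdeal_comp_equiv (R := R) (finCongr (Nat.add_right_comm r 1 k))
      (Fin.cons (m 0) (Fin.append (Fin.tail m) e))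
    refine hcast.trans ((relationDetIdeal_cons _ _ ?_).trans (ih _))
    refine Submodule.span_mono ?_ (he.ge (Submodule.mem_top (x := m 0)))
    rintro _ ⟨i, rfl⟩
    exact ⟨Fin.natAdd r i, Fin.append_right _ _ i⟩

/-- Both families are compared with their concatenation, which is redundant over either of them. -/
lemma relationDetIdeal_eq {k r : ℕ} (e : Fin k → M) (m : Fin r → M)
    (he : Submodule.span R (Set.range e) = ⊤) (hm : Submodule.span R (Set.range m) = ⊤) :
    relationDetIdeal R m = relationDetIdeal R e := by
  rw [← relationDetIdeal_append e m he, ← relationDetIdeal_append m e hm,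
    ← relationDetIdeal_comp_equiv finAddFlip]
  congr 1
  ext i
  refine Fin.addCases (fun i => ?_) (fun i => ?_) i <;> simp

lemma fittingIdeal_eq_relationDetIdeal {k : ℕ} (e : Fin k → M)
    (he : Submodule.span R (Set.range e) = ⊤) : fittingIdeal R M = relationDetIdeal R e := by
  refine le_antisymm (Ideal.span_le.2 ?_) (Ideal.span_le.2 ?_)
  · rintro _ ⟨r, m, A, hm, hA, rfl⟩
    rw [← relationDetIdeal_eq e m he hm]
    exact Ideal.subset_span ⟨A, hA, rfl⟩
  · rintro _ ⟨A, hA, rfl⟩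
    exact Ideal.subset_span ⟨k, e, A, he, hA, rfl⟩

lemma fittingIdeal_le_of_surjective {R : Type*} [CommRing R] {M N : Type*}
    [AddCommGroup M] [AddCommGroup N] [Module R M] [Module R N] (f : M →ₗ[R] N)
    (hf : Function.Surjective f) : fittingIdeal R M ≤ fittingIdeal R N := by
  refine Ideal.span_le.2 ?_
  rintro _ ⟨r, m, A, hm, hA, rfl⟩
  refine Ideal.subset_span ⟨r, f ∘ m, A, ?_, fun i => ?_, rfl⟩
  · rw [Set.range_comp, ← Submodule.map_span, hm, Submodule.map_top, LinearMap.range_eq_top.2 hf]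
  · simpa using congrArg f (hA i)

lemma LinearEquiv.fittingIdeal_eq {R : Type*} [CommRing R] {M N : Type*}
    [AddCommGroup M] [AddCommGroup N] [Module R M] [Module R N] (f : M ≃ₗ[R] N) :
    fittingIdeal R M = fittingIdeal R N :=
  le_antisymm (fittingIdeal_le_of_surjective f.toLinearMap f.surjective)
    (fittingIdeal_le_of_surjective f.symm.toLinearMap f.symm.surjective)

lemma fittingIdeal_map_isLocalizedModule (S : Submonoid R) (R' : Type*) [CommRing R'] [Algebra R R']
    [IsLocalization S R'] {M' : Type*} [AddCommGroup M'] [Module R M'] [Module R' M']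
    [IsScalarTower R R' M'] (f : M →ₗ[R] M') [IsLocalizedModule S f] [Module.Finite R M] :
    (fittingIdeal R M).map (algebraMap R R') = fittingIdeal R' M' := by
  refine le_antisymm ?_ ?_
  · rw [Ideal.map_le_iff_le_comap]
    refine Ideal.span_le.2 ?_
    rintro _ ⟨r, m, A, hm, hA, rfl⟩
    refine Ideal.subset_span ⟨r, f ∘ m, A.map (algebraMap R R'), ?_, fun i => ?_, ?_⟩
    · have := span_eq_top_of_isLocalizedModule R' S f hm
      rwa [← Set.range_comp] at this
    · simpa using congrArg f (hA i)
    · rw [← RingHom.mapMatrix_apply, ← RingHom.map_det]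
  · obtain ⟨k, e, he⟩ := Module.Finite.exists_fin (R := R) (M := M)
    have he' : Submodule.span R' (Set.range (f ∘ e)) = ⊤ := by
      have := span_eq_top_of_isLocalizedModule R' S f he
      rwa [← Set.range_comp] at this
    rw [fittingIdeal_eq_relationDetIdeal (f ∘ e) he', fittingIdeal_eq_relationDetIdeal e he]
    refine Ideal.span_le.2 ?_
    rintro _ ⟨A, hA, rfl⟩
    -- clear denominators
    obtain ⟨s, hs⟩ := IsLocalization.exist_integer_multiples_of_finite S
      (fun p : Fin k × Fin k => A p.1 p.2)
    choose B hB using fun i j => hs (i, j)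
    -- The cleared rows are relations only after applying `f`; another factor `t i` from `S` makes
    -- them relations in `M`. The determinant changes by the product of all factors, a unit of `R'`.
    have key : ∀ i, ∃ t : S, (t : R) • ∑ j, B i j • e j = 0 := by
      intro i
      have h1 : f (∑ j, B i j • e j) = 0 := by
        have : f (∑ j, B i j • e j) = (s : R) • ∑ j, A i j • f (e j) := by
          simp only [map_sum, map_smul, Finset.smul_sum]
          refine Finset.sum_congr rfl fun j _ => ?_
          rw [← algebraMap_smul R' (B i j), hB i j, smul_assoc]
        rw [this]
        have := hA i
        simp only [Function.comp] at this
        rw [this, smul_zero]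
      rw [← map_zero f] at h1
      obtain ⟨t, ht⟩ := (IsLocalizedModule.eq_iff_exists S f).1 h1
      exact ⟨t, by simpa using! ht⟩
    choose t ht using key
    have hdet : algebraMap R R' (Matrix.det (Matrix.of fun i j => (t i : R) * B i j)) =
        algebraMap R R' (∏ i, (t i : R) * s) * A.det := by
      rw [RingHom.map_det, map_prod, ← Matrix.det_mul_column]
      congr 1
      ext i j
      simp only [RingHom.mapMatrix_apply, Matrix.map_apply, Matrix.of_apply, map_mul, hB,
        Algebra.smul_def, mul_assoc]
    have hu : IsUnit (algebraMap R R' (∏ i, (t i : R) * s)) := by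
      refine IsLocalization.map_units R' (⟨∏ i, (t i : R) * s, ?_⟩ : S)
      exact Submonoid.prod_mem _ fun i _ => mul_mem (t i).2 s.2
    rw [SetLike.mem_coe, ← Ideal.unit_mul_mem_iff_mem _ hu, ← hdet]
    refine Ideal.mem_map_of_mem _ (Ideal.subset_span ⟨_, fun i => ?_, rfl⟩)
    simpa [Finset.smul_sum, smul_smul] using ht i

variable {n : ℕ}

/-- A row is a relation among the images of the basis exactly when it is the coordinate vector of an
element of `N`. -/
lemma fittingIdeal_quotient_of_basis (b : Module.Basis (Fin n) R M) (N : Submodule R M) :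
    fittingIdeal R (M ⧸ N) = Ideal.span {d | ∃ v : Fin n → M, (∀ i, v i ∈ N) ∧ d = b.det v} := by
  rw [fittingIdeal_eq_relationDetIdeal (N.mkQ ∘ b)]
  · unfold relationDetIdeal
    congr 1
    ext d
    constructor
    · rintro ⟨A, hA, rfl⟩
      refine ⟨fun i => ∑ j, A i j • b j, fun i => ?_, ?_⟩
      · rw [← Submodule.Quotient.mk_eq_zero, ← N.mkQ_apply]
        simpa using hA i
      · rw [Module.Basis.det_apply, ← Matrix.det_transpose]
        congr 1
        ext i j
        rw [Module.Basis.toMatrix_apply, b.repr_sum_self, Matrix.transpose_apply]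
    · rintro ⟨v, hv, rfl⟩
      refine ⟨(b.toMatrix v).transpose, fun i => ?_, ?_⟩
      · simp only [Matrix.transpose_apply, Function.comp_apply, ← map_smul, ← map_sum,
          Module.Basis.sum_toMatrix_smul_self]
        simpa using hv i
      · rw [Matrix.det_transpose, Module.Basis.det_apply]
  · rw [Set.range_comp, ← Submodule.map_span, b.span_eq, Submodule.map_top, Submodule.range_mkQ]

lemma fittingIdeal_quotient_map (b : Module.Basis (Fin n) R M) (N : Submodule R M)
    (φ : M →ₗ[R] M) :
    fittingIdeal R (M ⧸ N.map φ) = Ideal.span {LinearMap.det φ} * fittingIdeal R (M ⧸ N) := by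
  rw [fittingIdeal_quotient_of_basis b, fittingIdeal_quotient_of_basis b, Ideal.span_mul_span']
  congr 1
  ext d
  simp only [Set.singleton_mul, Set.mem_image, Set.mem_ofPred_eq]
  constructor
  · rintro ⟨v, hv, rfl⟩
    choose w hw hwv using hv
    refine ⟨_, ⟨w, hw, rfl⟩, ?_⟩
    rw [← b.det_comp]
    congr 1
    ext i
    exact hwv i
  · rintro ⟨_, ⟨v, hv, rfl⟩, rfl⟩
    exact ⟨φ ∘ v, fun i => ⟨_, hv i, rfl⟩, (b.det_comp _ _).symm⟩

/-- Elements of `J • ⊤` have coordinates in `J`, so every Leibniz term lies in `J ^ n`. Conversely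
the diagonal families `f i • b i` realize all products of `n` elements of `J`. -/
lemma fittingIdeal_quotient_smul_top (b : Module.Basis (Fin n) R M) (J : Ideal R) :
    fittingIdeal R (M ⧸ (J • ⊤ : Submodule R M)) = J ^ n := by
  rw [fittingIdeal_quotient_of_basis b]
  refine le_antisymm (Ideal.span_le.2 ?_) ?_
  · rintro _ ⟨v, hv, rfl⟩
    have hrepr : ∀ i j, b.repr (v i) j ∈ J := by
      intro i j
      have := Submodule.mem_map_of_mem (f := b.coord j) (hv i)
      rw [Submodule.map_smul''] at this
      have h2 := Submodule.smul_mono le_rfl (le_top (a := Submodule.map (b.coord j) ⊤)) this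
      simpa using h2
    rw [Module.Basis.det_apply, Matrix.det_apply]
    refine Ideal.sum_mem _ fun σ _ => ?_
    rw [Units.smul_def, zsmul_eq_mul]
    refine Ideal.mul_mem_left _ _ ?_
    have := Ideal.prod_mem_prod (ι := Fin n) (s := Finset.univ) (I := fun _ => J)
      (x := fun i => b.toMatrix v (σ i) i) (fun i _ => hrepr i (σ i))
    simpa using this
  · conv_lhs => rw [← Ideal.span_eq J, Ideal.span, Submodule.span_pow]
    refine Submodule.span_mono ?_
    intro x hx
    obtain ⟨f, rfl⟩ := Set.mem_pow.1 hx
    refine ⟨fun i => (f i : R) • b i, fun i => Submodule.smul_mem_smul (f i).2 trivial, ?_⟩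
    rw [AlternatingMap.map_smul_univ, b.det_self, List.prod_ofFn, smul_eq_mul, mul_one]

end Fitting

/-! ### Generators at finitely many primes, determinants and norms. -/

section Algebra

/-- If an ideal is principal at finitely many pairwise incomparable primes, then a single element
of it generates it at all these primes. -/
lemma Ideal.exists_mem_generating_at_primes {R : Type*} [CommRing R] {ι : Type*} [Finite ι]
    (P : ι → Ideal R) [hP : ∀ i, (P i).IsPrime] (hinc : ∀ i j, P i ≤ P j → i = j)
    (I : Ideal R)
    (h : ∀ i, ∃ x ∈ I, ∀ y ∈ I, ∃ t ∉ P i, t * y ∈ Ideal.span {x}) :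
    ∃ f ∈ I, ∀ i, ∀ y ∈ I, ∃ t ∉ P i, t * y ∈ Ideal.span {f} := by
  classical
  cases nonempty_fintype ι
  choose x hxI hx using h
  -- Prime avoidance supplies `e i` outside `P i` but in every other prime. At `P i` the sum `∑ e j
  -- * x j` is then `e i * x i` plus a multiple of `x i` by an element of the maximal ideal, hence a
  -- unit times `x i`.
  have he : ∀ i, ∃ e ∉ P i, ∀ j ≠ i, e ∈ P j := by
    intro i
    have : ¬ (Finset.univ.erase i).inf P ≤ P i := by
      rw [Ideal.IsPrime.inf_le' (hP i)]
      rintro ⟨j, hj, hji⟩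
      exact Finset.ne_of_mem_erase hj (hinc j i hji)
    obtain ⟨e, he, hei⟩ := SetLike.not_le_iff_exists.1 this
    refine ⟨e, hei, fun j hj => ?_⟩
    exact (Finset.inf_le (f := P) (Finset.mem_erase.2 ⟨hj, Finset.mem_univ j⟩)) he
  choose e hei hej using he
  refine ⟨∑ i, e i * x i, Ideal.sum_mem _ fun i _ => I.mul_mem_left _ (hxI i), fun i y hy => ?_⟩
  have hrest : ∃ t ∉ P i, ∃ r ∈ P i, t * (∑ j ∈ Finset.univ.erase i, e j * x j) = r * x i := by
    refine Finset.sum_induction _ (fun z => ∃ t ∉ P i, ∃ r ∈ P i, t * z = r * x i) ?_ ?_ ?_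
    · rintro a b ⟨t, ht, r, hr, h⟩ ⟨t', ht', r', hr', h'⟩
      refine ⟨t * t', fun hh => ((hP i).mem_or_mem hh).elim ht ht', t' * r + t * r',
        add_mem (Ideal.mul_mem_left _ _ hr) (Ideal.mul_mem_left _ _ hr'), ?_⟩
      linear_combination t' * h + t * h'
    · exact ⟨1, (Ideal.ne_top_iff_one _).1 (hP i).ne_top, 0, zero_mem _, by simp⟩
    · intro j hj
      obtain ⟨t, ht, h⟩ := hx i (x j) (hxI j)
      obtain ⟨r, hr⟩ := Ideal.mem_span_singleton'.1 h
      refine ⟨t, ht, e j * r, Ideal.mul_mem_right _ _ (hej j i (Finset.ne_of_mem_erase hj).symm), ?_⟩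
      linear_combination - e j * hr
  obtain ⟨t, ht, r, hr, h⟩ := hrest
  obtain ⟨t', ht', h'⟩ := hx i y hy
  obtain ⟨r', hr'⟩ := Ideal.mem_span_singleton'.1 h'
  have hu : t * e i + r ∉ P i := fun hh =>
    ((hP i).mem_or_mem (((P i).add_mem_iff_left hr).1 hh)).elim ht (hei i)
  refine ⟨(t * e i + r) * t', fun hh => ((hP i).mem_or_mem hh).elim hu ht', ?_⟩
  refine Ideal.mem_span_singleton'.2 ⟨r' * t, ?_⟩
  rw [← Finset.add_sum_erase _ _ (Finset.mem_univ i)]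
  linear_combination r' * h - (t * e i + r) * (-hr')

/-- An injective endomorphism of a finite free module over a noetherian ring has a determinant
which is a nonzerodivisor. -/
lemma LinearMap.det_mem_nonZeroDivisors_of_injective {R : Type*} [CommRing R] [IsNoetherianRing R]
    {M : Type*} [AddCommGroup M] [Module R M] {ι : Type*} [Fintype ι] [DecidableEq ι]
    (b : Module.Basis ι R M) (φ : M →ₗ[R] M) (hφ : Function.Injective φ) :
    LinearMap.det φ ∈ nonZeroDivisors R := by
  -- A zero-divisor determinant lies in an associated prime `p`, the annihilator of some `c`. Modulo
  -- `p` the matrix kills a nonzero vector; for a lift `w`, the vector `c * w` is killed by `φ`.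
  -- Injectivity gives `c * w = 0`, so `w` vanishes modulo `p`, a contradiction.
  by_contra hdet
  have h1 : LinearMap.det φ ∈ ⋃ p ∈ associatedPrimes R R, (p : Set R) := by
    rw [biUnion_associatedPrimes_eq_compl_nonZeroDivisors]
    exact hdet
  simp only [Set.mem_iUnion] at h1
  obtain ⟨p, hp, hdp⟩ := h1
  obtain ⟨hprime, c, hc⟩ := (isAssociatedPrime_iff).1 hp
  have hmem : ∀ a, a ∈ p ↔ a * c = 0 := by
    intro a
    rw [hc, Submodule.mem_colon_singleton, smul_eq_mul, Submodule.mem_bot]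
  let A := LinearMap.toMatrix b b φ
  have hA : (A.map (Ideal.Quotient.mk p)).det = 0 := by
    rw [← RingHom.mapMatrix_apply, ← RingHom.map_det, LinearMap.det_toMatrix,
      Ideal.Quotient.eq_zero_iff_mem]
    exact hdp
  obtain ⟨v, hv, hAv⟩ := Matrix.exists_mulVec_eq_zero_iff.2 hA
  choose w hw using fun i => Ideal.Quotient.mk_surjective (v i)
  refine hv (funext fun i => ?_)
  rw [← hw i, Pi.zero_apply, Ideal.Quotient.eq_zero_iff_mem, hmem, mul_comm]
  have h0 : ∑ i, (c * w i) • b i = 0 := by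
    apply hφ
    rw [map_zero]
    apply b.repr.injective
    ext j
    have h2 : (A.mulVec w) j ∈ p := by
      rw [← Ideal.Quotient.eq_zero_iff_mem]
      refine Eq.trans ?_ (congrFun hAv j)
      simp [Matrix.mulVec, dotProduct, hw]
    rw [hmem] at h2
    have h3 := congrFun (LinearMap.toMatrix_mulVec_repr b b φ (∑ i, (c * w i) • b i)) j
    rw [← h3, b.repr_sum_self, map_zero, Finsupp.zero_apply, ← h2]
    simp only [Matrix.mulVec, dotProduct, Finset.sum_mul]
    exact Finset.sum_congr rfl fun i _ => by ring
  have h4 := congrFun (congrArg (fun x => ⇑(b.repr x)) h0) i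
  simpa only [b.repr_sum_self, map_zero, Finsupp.zero_apply] using h4

lemma fittingIdeal_restrictScalars {A B : Type*} [CommRing A] [CommRing B] [Algebra A B]
    (I : Ideal B) : fittingIdeal A (B ⧸ I) = fittingIdeal A (B ⧸ I.restrictScalars A) :=
  (Submodule.Quotient.restrictScalarsEquiv A I).symm.fittingIdeal_eq

variable {A B : Type*} [CommRing A] [CommRing B] [Algebra A B] {n : ℕ}
  (b : Module.Basis (Fin n) A B)

include b

/-- The ideal `f I` is the image of `I` under the `A`-linear multiplication by `f`, whose
determinant is the norm. -/
lemma fittingIdeal_span_singleton_mul (f : B) (I : Ideal B) :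
    fittingIdeal A (B ⧸ (Ideal.span {f} * I)) =
      Ideal.span {Algebra.norm A f} * fittingIdeal A (B ⧸ I) := by
  rw [fittingIdeal_restrictScalars, fittingIdeal_restrictScalars, Algebra.norm_apply,
    ← fittingIdeal_quotient_map b]
  have h : (Ideal.span {f} * I).restrictScalars A =
      (I.restrictScalars A).map (Algebra.lmul A B f) := by
    ext z
    exact Ideal.mem_span_singleton_mul
  rw [h]

lemma fittingIdeal_quotient_idealMap (J : Ideal A) :
    fittingIdeal A (B ⧸ J.map (algebraMap A B)) = J ^ n := by
  rw [fittingIdeal_restrictScalars, ← Ideal.smul_top_eq_map, fittingIdeal_quotient_smul_top b]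

lemma fittingIdeal_quotient_span_singleton (f : B) :
    fittingIdeal A (B ⧸ Ideal.span {f}) = Ideal.span {Algebra.norm A f} := by
  have h := fittingIdeal_span_singleton_mul b f ⊤
  have h2 := fittingIdeal_quotient_idealMap b (⊤ : Ideal A)
  rw [Ideal.map_top, Ideal.top_pow] at h2
  rwa [h2, Ideal.mul_top, Ideal.mul_top] at h

/-- The Fitting ideal of the quotient by the common ideal is computed from either side, with `g ^ n`
as the norm of `g`. -/
lemma span_pow_mul_fittingIdeal_eq (g : A) (f : B) (I : Ideal B) (J : Ideal A)
    (h : Ideal.span {algebraMap A B g} * I = Ideal.span {f} * J.map (algebraMap A B)) :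
    Ideal.span {g ^ n} * fittingIdeal A (B ⧸ I) = Ideal.span {Algebra.norm A f} * J ^ n := by
  rw [← fittingIdeal_quotient_idealMap b, ← fittingIdeal_span_singleton_mul b, ← h,
    fittingIdeal_span_singleton_mul b, Algebra.norm_algebraMap_of_basis b, Fintype.card_fin]

end Algebra

/-! ### Points and closed subsets of a curve. -/

section Topology

lemma exists_genericPoint_specializes {X : Type*} [TopologicalSpace X] [QuasiSober X] (x : X) :
    ∃ η ∈ genericPoints X, η ⤳ x := by
  have hirr := isIrreducible_irreducibleComponent (x := x)
  have hcl : closure {hirr.genericPoint} = irreducibleComponent x := by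
    rw [hirr.genericPoint_closure_eq, isClosed_irreducibleComponent.closure_eq]
  refine ⟨hirr.genericPoint, ?_, ?_⟩
  · change closure {hirr.genericPoint} ∈ irreducibleComponents X
    rw [hcl]
    exact irreducibleComponent_mem_irreducibleComponents x
  · rw [specializes_iff_mem_closure, hcl]
    exact mem_irreducibleComponent

/-- Otherwise the closures of `x`, of `y` and of a generic point above `y` form a chain of length
two in a component of dimension one. -/
lemma IsCurve.eq_of_specializes {X : Scheme.{u}} [IsCurve X] {x y : X} (hy : y ∉ genericPoints X)
    (h : y ⤳ x) : y = x := by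
  by_contra hne
  obtain ⟨η, hη, hηy⟩ := exists_genericPoint_specializes y
  have hηne : η ≠ y := fun e => hy (e ▸ hη)
  let Z : Set X := closure {η}
  have mem : ∀ {p : X}, η ⤳ p → p ∈ Z := fun h => specializes_iff_mem_closure.1 h
  let c : Z → IrreducibleCloseds Z := fun p =>
    ⟨closure {p}, isIrreducible_singleton.closure, isClosed_closure⟩
  have hlt : ∀ {p q : X} (hp : η ⤳ p) (hq : η ⤳ q), q ⤳ p → q ≠ p →
      c ⟨p, mem hp⟩ < c ⟨q, mem hq⟩ := by
    intro p q hp hq hqp hne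
    have hle : (⟨q, mem hq⟩ : Z) ⤳ ⟨p, mem hp⟩ := by
      rwa [← Topology.IsInducing.subtypeVal.specializes_iff]
    refine lt_of_le_not_ge (show closure _ ⊆ closure _ from
      specializes_iff_closure_subset.1 hle) fun hge => hne ?_
    have h2 : (⟨p, mem hp⟩ : Z) ⤳ ⟨q, mem hq⟩ := specializes_iff_closure_subset.2 hge
    exact congrArg Subtype.val (hle.antisymm h2).eq
  have h1 := hlt (hηy.trans h) hηy h hne
  have h2 := hlt hηy specializes_rfl hηy hηne
  have hlen := Order.LTSeries.length_le_krullDim (α := IrreducibleCloseds Z)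
    ⟨2, ![c ⟨x, mem (hηy.trans h)⟩, c ⟨y, mem hηy⟩, c ⟨η, mem specializes_rfl⟩], fun i => by
      fin_cases i
      · exact h1
      · exact h2⟩
  have hdim : Order.krullDim (IrreducibleCloseds Z) = 1 := IsCurve.dim_component Z hη
  rw [hdim] at hlen
  have h21 : ((2 : ℕ) : WithBot ℕ∞) ≤ ((1 : ℕ) : WithBot ℕ∞) := hlen
  exact absurd (by exact_mod_cast h21) (by decide : ¬ 2 ≤ 1)

/-- Each of the finitely many irreducible pieces has a generic point that is not generic in `X`,
hence has no proper specialization; the piece is a single point. -/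
lemma IsCurve.finite_of_isClosed {X : Scheme.{u}} [IsCurve X] (Z : Closeds X)
    (hZ : ∀ x ∈ Z, x ∉ genericPoints X) : (Z : Set X).Finite := by
  obtain ⟨S, hS, hcl, hirr, hU⟩ :=
    NoetherianSpace.exists_finite_set_isClosed_irreducible Z.isClosed
  rw [hU]
  refine hS.sUnion fun t ht => Set.Subsingleton.finite ?_
  have hg : ∀ p ∈ t, (hirr t ht).genericPoint = p := fun p hp => by
    refine IsCurve.eq_of_specializes (hZ _ ?_) 
      (((hirr t ht).isGenericPoint_genericPoint (hcl t ht)).specializes hp)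
    change _ ∈ (Z : Set X)
    rw [hU]
    exact ⟨t, ht, ((hirr t ht).isGenericPoint_genericPoint (hcl t ht)).mem⟩
  exact fun p hp q hq => (hg p hp).symm.trans (hg q hq)

/-- A point which is minimal under specialization in a closed set is isolated in it. -/
lemma exists_open_inter_subset_singleton {X : Type*} [TopologicalSpace X] [QuasiSober X]
    [NoetherianSpace X] (Z : Closeds X) (x : X) (hx : IsClosed {x})
    (h : ∀ z ∈ Z, z ⤳ x → z = x) :
    ∃ O : Opens X, x ∈ O ∧ ∀ z ∈ O, z ∈ Z → z = x := by
  obtain ⟨S, hS, hcl, hirr, hU⟩ :=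
    NoetherianSpace.exists_finite_set_isClosed_irreducible Z.isClosed
  -- Remove the pieces that miss `x`. A remaining piece has a generic point specializing to `x`,
  -- hence equal to `x`, so the piece is `{x}`.
  refine ⟨⟨(⋃₀ {t ∈ S | x ∉ t})ᶜ, by
    rw [Set.sUnion_eq_biUnion]
    exact ((hS.subset (Set.sep_subset _ _)).isClosed_biUnion fun t ht => hcl t ht.1).isOpen_compl⟩, fun ⟨t, ht, hxt⟩ => ht.2 hxt, fun z hzO hzZ => ?_⟩
  have hz' : z ∈ (Z : Set X) := hzZ
  rw [hU] at hz'
  obtain ⟨t, ht, hzt⟩ := hz'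
  have hxt : x ∈ t := by
    by_contra hxt
    exact hzO ⟨t, ⟨ht, hxt⟩, hzt⟩
  have hg := (hirr t ht).isGenericPoint_genericPoint (hcl t ht)
  have hgZ : (hirr t ht).genericPoint ∈ (Z : Set X) := by
    rw [hU]
    exact ⟨t, ht, hg.mem⟩
  have hgx := h _ hgZ (hg.specializes hxt)
  have hz := hg.specializes hzt
  rw [hgx, specializes_iff_mem_closure, hx.closure_eq] at hz
  exact hz

end Topology

/-! ### Invertible submodules and common denominators. -/

section Denominators

variable {R : Type*} [CommRing R] {K : Type*} [CommRing K] [Algebra R K]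

lemma Submodule.one_div_span_singleton_units (f : Kˣ) :
    (1 : Submodule R K) / Submodule.span R {(f : K)} = Submodule.span R {((f⁻¹ : Kˣ) : K)} := by
  ext z
  rw [Submodule.mem_div_iff_forall_mul_mem, Submodule.mem_span_singleton]
  constructor
  · intro h
    obtain ⟨r, hr⟩ := Submodule.mem_one.1 (h f (Submodule.mem_span_singleton_self _))
    exact ⟨r, by rw [Algebra.smul_def, hr, Units.mul_inv_cancel_right]⟩
  · rintro ⟨r, rfl⟩ y hy
    obtain ⟨t, rfl⟩ := Submodule.mem_span_singleton.1 hy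
    rw [smul_mul_smul_comm, Units.inv_mul]
    exact Submodule.smul_mem _ _ (Submodule.one_le.1 le_rfl)

lemma Submodule.span_singleton_units_mul_one_div (f : Kˣ) :
    Submodule.span R {(f : K)} * (1 / Submodule.span R {(f : K)}) = 1 := by
  rw [one_div_span_singleton_units, Submodule.span_mul_span, Set.singleton_mul_singleton,
    Units.mul_inv, Submodule.one_eq_span]

lemma Submodule.exists_nonZeroDivisor_mul_mem_one [IsFractionRing R K] (N : Submodule R K)
    (hN : N.FG) : ∃ f ∈ nonZeroDivisors R, ∀ z ∈ N, algebraMap R K f * z ∈ (1 : Submodule R K) := by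
  obtain ⟨S, rfl⟩ := hN
  obtain ⟨f, hf⟩ := IsLocalization.exist_integer_multiples_of_finset (nonZeroDivisors R) S
  refine ⟨f, f.2, fun z hz => ?_⟩
  induction hz using Submodule.span_induction with
  | mem z hz =>
    obtain ⟨c, hc⟩ := hf z hz
    exact Submodule.mem_one.2 ⟨c, by rw [hc, Algebra.smul_def]⟩
  | zero => rw [mul_zero]; exact zero_mem _
  | add a b _ _ ha hb => rw [mul_add]; exact add_mem ha hb
  | smul r a _ ha => rw [mul_smul_comm]; exact Submodule.smul_mem _ _ ha

end Denominators

/-! ### Germs, regular sections and local generators. -/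

namespace GeneralizedDivisor

variable {X : Scheme.{u}}

lemma fg_stalk (D : GeneralizedDivisor X) (x : X) : (D.stalk x).FG := by
  obtain ⟨U, hx, ι, _, s, hs, h⟩ := D.coherent x
  rw [h ⟨x, hx⟩]
  exact Submodule.fg_span (Set.finite_range _)

lemma one_eq_top_of_mem_genericPoints {η : X} (hη : η ∈ genericPoints X) :
    (1 : Submodule (X.presheaf.stalk η) (TotalQuotient X η)) = ⊤ :=
  (0 : GeneralizedDivisor X).nondegenerate η hη

lemma isUnit_of_mem_nonZeroDivisors {η : X} (hη : η ∈ genericPoints X) {b : X.presheaf.stalk η}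
    (hb : b ∈ nonZeroDivisors (X.presheaf.stalk η)) : IsUnit b := by
  have h : IsLocalization.mk' (TotalQuotient X η) 1 ⟨b, hb⟩ ∈
      (1 : Submodule (X.presheaf.stalk η) (TotalQuotient X η)) := by
    rw [one_eq_top_of_mem_genericPoints hη]; trivial
  obtain ⟨c, hc⟩ := Submodule.mem_one.1 h
  rw [IsLocalization.eq_mk'_iff_mul_eq, ← map_mul] at hc
  exact IsUnit.of_mul_eq_one_right c (IsFractionRing.injective _ (TotalQuotient X η) hc)

lemma isUnit_algebraMap_of_mem_nonZeroDivisors {x : X} {b : X.presheaf.stalk x}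
    (hb : b ∈ nonZeroDivisors (X.presheaf.stalk x)) : IsUnit (algebraMap _ (TotalQuotient X x) b) :=
  IsLocalization.map_units (TotalQuotient X x) (⟨b, hb⟩ : nonZeroDivisors _)

/-- A section of the sheaf of total quotients which is regular at a point is regular nearby. -/
lemma _root_.IsTotalQuotientSection.exists_eq_germ {U : X.Opens} {s : ∀ y : U, TotalQuotient X y}
    (hs : IsTotalQuotientSection s) (y : U)
    (hy : s y ∈ (1 : Submodule (X.presheaf.stalk y) (TotalQuotient X y))) :
    ∃ (V : X.Opens) (_ : y.1 ∈ V) (hVU : V ≤ U) (c : Γ(X, V)), ∀ (z : X) (hz : z ∈ V),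
      s ⟨z, hVU hz⟩ = algebraMap _ (TotalQuotient X z) (X.presheaf.germ V z hz c) := by
  obtain ⟨V, hyV, hVU, a, b, hab⟩ := hs y
  obtain ⟨y, hyU⟩ := y
  obtain ⟨c₀, hc₀⟩ := Submodule.mem_one.1 hy
  obtain ⟨W, hyW, c, rfl⟩ : ∃ (W : X.Opens) (hyW : y ∈ W) (c : Γ(X, W)),
    X.presheaf.germ W y hyW c = c₀ := X.presheaf.exists_germ_eq c₀
  have h1 : X.presheaf.germ V y hyV a = X.presheaf.germ V y hyV b * X.presheaf.germ W y hyW c := by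
    apply IsFractionRing.injective _ (TotalQuotient X y)
    rw [map_mul, hc₀]
    exact (hab y hyV).2.symm
  have hV : V ⊓ W ≤ V := inf_le_left
  have hW : V ⊓ W ≤ W := inf_le_right
  have hy' : y ∈ V ⊓ W := ⟨hyV, hyW⟩
  have h2 : X.presheaf.germ (V ⊓ W) y hy' (X.presheaf.map (homOfLE hV).op a) =
      X.presheaf.germ (V ⊓ W) y hy' (X.presheaf.map (homOfLE hV).op b *
        X.presheaf.map (homOfLE hW).op c) := by
    simpa only [map_mul, TopCat.Presheaf.germ_res_apply] using h1
  obtain ⟨V', hyV', i, j, hij⟩ := X.presheaf.germ_eq _ _ _ _ _ h2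
  refine ⟨V', hyV', (leOfHom i).trans (inf_le_left.trans hVU),
    X.presheaf.map (homOfLE ((leOfHom i).trans inf_le_right)).op c, fun z hz => ?_⟩
  obtain ⟨h3, h4⟩ := hab z ((leOfHom i).trans inf_le_left hz)
  apply (isUnit_algebraMap_of_mem_nonZeroDivisors h3).mul_left_cancel
  rw [h4, ← map_mul]
  congr 1
  have h5 := congrArg (X.presheaf.germ V' z hz) hij
  simpa only [map_mul, TopCat.Presheaf.germ_res_apply] using h5

/-- A generalized divisor which is effective at a point is, near this point, given by an ideal
generated by finitely many regular functions. -/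
lemma exists_generators (D : GeneralizedDivisor X) (x : X) (hx : D.stalk x ≤ 1) :
    ∃ (V : X.Opens) (_ : x ∈ V) (ι : Type) (_ : Finite ι) (c : ι → Γ(X, V)),
      ∀ (z : X) (hz : z ∈ V), D.stalk z = Submodule.span _
        (Set.range fun i => algebraMap _ (TotalQuotient X z) (X.presheaf.germ V z hz (c i))) := by
  obtain ⟨U, hxU, ι, _, s, hs, h⟩ := D.coherent x
  choose V hxV hVU c hc using fun i => (hs i).exists_eq_germ ⟨x, hxU⟩
    (hx (by rw [h ⟨x, hxU⟩]; exact Submodule.subset_span ⟨i, rfl⟩))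
  let W : X.Opens := U ⊓ ⟨⋂ i, (V i : Set X), isOpen_iInter_of_finite fun i => (V i).isOpen⟩
  have hWV : ∀ i, W ≤ V i := fun i z hz => Set.mem_iInter.1 hz.2 i
  refine ⟨W, ⟨hxU, Set.mem_iInter.2 hxV⟩, ι, inferInstance,
    fun i => X.presheaf.map (homOfLE (hWV i)).op (c i), fun z hz => ?_⟩
  rw [h ⟨z, hz.1⟩]
  simp only [TopCat.Presheaf.germ_res_apply]
  congr! 3 with i
  exact hc i z (hWV i hz)

lemma _root_.AlgebraicGeometry.IsAffineOpen.exists_mul_eq_zero {V : X.Opens}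
    (hV : IsAffineOpen V) {x : X} (hx : x ∈ V) {a : Γ(X, V)} (h : X.presheaf.germ V x hx a = 0) :
    ∃ t : Γ(X, V), IsUnit (X.presheaf.germ V x hx t) ∧ t * a = 0 := by
  let := X.presheaf.algebra_section_stalk ⟨x, hx⟩
  have := hV.isLocalization_stalk ⟨x, hx⟩
  obtain ⟨t, ht⟩ := (IsLocalization.map_eq_zero_iff (hV.primeIdealOf ⟨x, hx⟩).asIdeal.primeCompl
    (X.presheaf.stalk x) a).1 h
  exact ⟨t, IsLocalization.map_units (X.presheaf.stalk x) t, ht⟩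

lemma _root_.AlgebraicGeometry.IsAffineOpen.exists_germ_mul_eq {V : X.Opens}
    (hV : IsAffineOpen V) {x : X} (hx : x ∈ V) (z : X.presheaf.stalk x) :
    ∃ a t : Γ(X, V), IsUnit (X.presheaf.germ V x hx t) ∧
      z * X.presheaf.germ V x hx t = X.presheaf.germ V x hx a := by
  let := X.presheaf.algebra_section_stalk ⟨x, hx⟩
  have := hV.isLocalization_stalk ⟨x, hx⟩
  obtain ⟨⟨a, t⟩, h⟩ := IsLocalization.surj (hV.primeIdealOf ⟨x, hx⟩).asIdeal.primeCompl z
  exact ⟨a, t, IsLocalization.map_units (X.presheaf.stalk x) t, h⟩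

lemma _root_.AlgebraicGeometry.IsAffineOpen.exists_mul_mem {V : X.Opens}
    (hV : IsAffineOpen V) {x : X} (hx : x ∈ V) {a : Γ(X, V)} {I : Ideal Γ(X, V)}
    (h : X.presheaf.germ V x hx a ∈ I.map (X.presheaf.germ V x hx).hom) :
    ∃ t : Γ(X, V), IsUnit (X.presheaf.germ V x hx t) ∧ t * a ∈ I := by
  let := X.presheaf.algebra_section_stalk ⟨x, hx⟩
  have := hV.isLocalization_stalk ⟨x, hx⟩
  obtain ⟨t, ht, h⟩ := (IsLocalization.algebraMap_mem_map_algebraMap_iff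
    (hV.primeIdealOf ⟨x, hx⟩).asIdeal.primeCompl (X.presheaf.stalk x) I a).1 h
  exact ⟨t, IsLocalization.map_units (X.presheaf.stalk x)
    (⟨t, ht⟩ : (hV.primeIdealOf ⟨x, hx⟩).asIdeal.primeCompl), h⟩

lemma isUnit_germ_of_specializes {W : X.Opens} {f : Γ(X, W)} {x ξ : X} {hx : x ∈ W}
    (h : ξ ⤳ x) {hξ : ξ ∈ W} (hf : IsUnit (X.presheaf.germ W x hx f)) :
    IsUnit (X.presheaf.germ W ξ hξ f) := by
  rw [← X.mem_basicOpen f x hx] at hf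
  rw [← X.mem_basicOpen f ξ hξ]
  exact h.mem_open (X.basicOpen f).isOpen hf

/-- The stalk at `ξ` is a localization of the stalk at `x`, and localization preserves
nonzerodivisors. The argument runs through sections over an affine open containing both points. -/
lemma germ_mem_nonZeroDivisors_of_specializes {W : X.Opens} (f : Γ(X, W)) {x ξ : X} (hx : x ∈ W)
    (h : ξ ⤳ x) (hξ : ξ ∈ W)
    (hf : X.presheaf.germ W x hx f ∈ nonZeroDivisors (X.presheaf.stalk x)) :
    X.presheaf.germ W ξ hξ f ∈ nonZeroDivisors (X.presheaf.stalk ξ) := by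
  obtain ⟨V, hV, hxV, hVW⟩ := exists_isAffineOpen_mem_and_subset hx
  replace hVW : V ≤ W := hVW
  have hξV : ξ ∈ V := h.mem_open V.isOpen hxV
  rw [← X.presheaf.germ_res_apply (homOfLE hVW) x hxV] at hf
  rw [← X.presheaf.germ_res_apply (homOfLE hVW) ξ hξV]
  generalize X.presheaf.map (homOfLE hVW).op f = g at hf ⊢
  rw [mem_nonZeroDivisors_iff_right] at hf ⊢
  intro z hz
  obtain ⟨a, t, ht, ha⟩ := hV.exists_germ_mul_eq hξV z
  have h1 : X.presheaf.germ V ξ hξV (a * g) = 0 := by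
    rw [map_mul, ← ha, mul_right_comm, hz, zero_mul]
  obtain ⟨s, hs, hs'⟩ := hV.exists_mul_eq_zero hξV h1
  have h2 : X.presheaf.germ V x hxV (s * a) = 0 := by
    apply hf
    rw [← map_mul, mul_assoc, hs', map_zero]
  obtain ⟨r, hr, hr'⟩ := hV.exists_mul_eq_zero hxV h2
  have h3 := congrArg (X.presheaf.germ V ξ hξV) hr'
  rw [map_mul, map_mul, map_zero, (isUnit_germ_of_specializes h hr).mul_right_eq_zero,
    hs.mul_right_eq_zero, ← ha, ht.mul_left_eq_zero] at h3
  exact h3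

end GeneralizedDivisor

/-! ### Existence of decompositions D = E - F. -/

namespace GeneralizedDivisor

variable {X : Scheme.{u}}

lemma exists_open_stalk_le_one (D : GeneralizedDivisor X) {x : X} (hx : D.stalk x ≤ 1) :
    ∃ V : X.Opens, x ∈ V ∧ ∀ z ∈ V, D.stalk z ≤ 1 := by
  obtain ⟨V, hxV, ι, _, c, hc⟩ := D.exists_generators x hx
  refine ⟨V, hxV, fun z hz => ?_⟩
  rw [hc z hz, Submodule.span_le]
  rintro _ ⟨i, rfl⟩
  exact Submodule.mem_one.2 ⟨_, rfl⟩

/-- The closed set of points where a generalized divisor is not effective. -/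
def nonEffectiveLocus (D : GeneralizedDivisor X) : Closeds X where
  carrier := {x | ¬ D.stalk x ≤ 1}
  isClosed' := by
    rw [← isOpen_compl_iff, isOpen_iff_forall_mem_open]
    intro x hx
    obtain ⟨V, hxV, hV⟩ := D.exists_open_stalk_le_one (not_not.1 hx)
    exact ⟨V, fun z hz => not_not.2 (hV z hz), V.isOpen, hxV⟩

lemma mem_nonEffectiveLocus {D : GeneralizedDivisor X} {x : X} :
    x ∈ D.nonEffectiveLocus ↔ ¬ D.stalk x ≤ 1 := Iff.rfl

lemma notMem_genericPoints_of_mem_nonEffectiveLocus {D : GeneralizedDivisor X} {x : X}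
    (hx : x ∈ D.nonEffectiveLocus) : x ∉ genericPoints X := fun h => by
  rw [mem_nonEffectiveLocus, one_eq_top_of_mem_genericPoints h] at hx
  exact hx le_top

lemma span_algebraMap_eq_one_of_isUnit {x : X} {b : X.presheaf.stalk x} (hb : IsUnit b) :
    Submodule.span (X.presheaf.stalk x) {algebraMap _ (TotalQuotient X x) b} = 1 := by
  refine le_antisymm ?_ ?_
  · rw [Submodule.span_singleton_le_iff_mem]
    exact Submodule.mem_one.2 ⟨b, rfl⟩
  · rw [Submodule.one_le, Submodule.mem_span_singleton]
    obtain ⟨u, rfl⟩ := hb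
    exact ⟨↑u⁻¹, by rw [Algebra.smul_def, ← map_mul, Units.inv_mul, map_one]⟩

lemma isTotalQuotientSection_germ {U : X.Opens} (c : Γ(X, U)) :
    IsTotalQuotientSection (U := U)
      (fun z => algebraMap _ (TotalQuotient X z.1) (X.presheaf.germ U z.1 z.2 c)) := by
  intro y
  refine ⟨U, y.2, le_rfl, c, 1, fun z hz => ⟨?_, ?_⟩⟩
  · rw [map_one]
    exact one_mem _
  · rw [map_one, map_one, one_mul]

lemma IsCartier.mul_one_div {F : GeneralizedDivisor X} (hF : F.IsCartier) (x : X) :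
    F.stalk x * (1 / F.stalk x) = 1 := by
  obtain ⟨f, hf⟩ := hF x
  rw [hf, Submodule.span_singleton_units_mul_one_div]

lemma IsCartier.isDifference_add {F : GeneralizedDivisor X} (hF : F.IsCartier)
    (D : GeneralizedDivisor X) : D.IsDifference (D + F) F := fun x => by
  rw [add_stalk, mul_assoc, hF.mul_one_div, mul_one]

/-- For a regular function at a closed point, its zeros near this point are contained in the
point, if it is a nonzerodivisor. -/
lemma exists_isUnit_germ_punctured [IsCurve X] {x : X} (hx : x ∉ genericPoints X) (W : X.Opens)
    (hxW : x ∈ W) (f : Γ(X, W))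
    (hf : X.presheaf.germ W x hxW f ∈ nonZeroDivisors (X.presheaf.stalk x)) :
    ∃ O : X.Opens, x ∈ O ∧ ∃ hOW : O ≤ W, ∀ (z : X) (hz : z ∈ O), z ≠ x →
      IsUnit (X.presheaf.germ W z (hOW hz) f) := by
  have hclosed : IsClosed {x} := by
    rw [← closure_subset_iff_isClosed]
    intro z hz
    exact (IsCurve.eq_of_specializes hx (specializes_iff_mem_closure.2 hz)).symm
  -- Apply isolation to the zero locus of `f`: a point other than `x` specializing to `x` is
  -- generic, and there a nonzerodivisor is a unit.
  obtain ⟨O, hxO, hO⟩ := exists_open_inter_subset_singleton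
    (⟨(X.basicOpen f : Set X)ᶜ, (X.basicOpen f).isOpen.isClosed_compl⟩ : Closeds X) x hclosed (by
      intro z hz hzx
      by_contra hne
      have hzW : z ∈ W := hzx.mem_open W.isOpen hxW
      refine hz ((X.mem_basicOpen f z hzW).2 ?_)
      refine isUnit_of_mem_nonZeroDivisors ?_
        (germ_mem_nonZeroDivisors_of_specializes f hxW hzx hzW hf)
      by_contra hgen
      exact hne (IsCurve.eq_of_specializes hgen hzx))
  refine ⟨O ⊓ W, ⟨hxO, hxW⟩, inf_le_right, fun z hz hne => ?_⟩
  rw [← X.mem_basicOpen f z]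
  by_contra h
  exact hne (hO z hz.1 h)

/-- The non-effective locus is a finite set of closed points. Let `F` be generated by a denominator
of `D` at each of them and by 1 elsewhere; this is coherent because a denominator is invertible on a
punctured neighbourhood. -/
lemma exists_isCartier_add_isEffective [IsCurve X] (D : GeneralizedDivisor X) :
    ∃ F : GeneralizedDivisor X, F.IsEffective ∧ F.IsCartier ∧ (D + F).IsEffective := by
  classical
  have hfin : (D.nonEffectiveLocus : Set X).Finite :=
    IsCurve.finite_of_isClosed _ fun x hx => notMem_genericPoints_of_mem_nonEffectiveLocus hx
  have hclosed : ∀ S ⊆ (D.nonEffectiveLocus : Set X), IsClosed S := by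
    intro S hS
    rw [← Set.biUnion_of_singleton S]
    refine (hfin.subset hS).isClosed_biUnion fun x hx => ?_
    rw [← closure_subset_iff_isClosed]
    intro z hz
    exact (IsCurve.eq_of_specializes (notMem_genericPoints_of_mem_nonEffectiveLocus (hS hx))
      (specializes_iff_mem_closure.2 hz)).symm
  have hf : ∀ x, ∃ f ∈ nonZeroDivisors (X.presheaf.stalk x), (x ∉ D.nonEffectiveLocus → f = 1) ∧
      ∀ z ∈ D.stalk x, algebraMap _ (TotalQuotient X x) f * z ∈
        (1 : Submodule (X.presheaf.stalk x) (TotalQuotient X x)) := by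
    intro x
    by_cases hx : x ∈ D.nonEffectiveLocus
    · obtain ⟨f, hf, h⟩ := Submodule.exists_nonZeroDivisor_mul_mem_one _ (D.fg_stalk x)
      exact ⟨f, hf, fun h => absurd hx h, h⟩
    · refine ⟨1, one_mem _, fun _ => rfl, fun z hz => ?_⟩
      rw [map_one, one_mul]
      exact not_not.1 hx hz
  choose f hf hf1 hfD using hf
  let F : GeneralizedDivisor X :=
    { stalk := fun x => Submodule.span _ {algebraMap _ (TotalQuotient X x) (f x)}
      coherent := by
        intro x
        by_cases hx : x ∈ D.nonEffectiveLocus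
        · obtain ⟨W, hxW, f₀, hf₀⟩ : ∃ (W : X.Opens) (hxW : x ∈ W) (c : Γ(X, W)),
            X.presheaf.germ W x hxW c = f x := X.presheaf.exists_germ_eq (f x)
          obtain ⟨O, hxO, hOW, hO⟩ := exists_isUnit_germ_punctured
            (notMem_genericPoints_of_mem_nonEffectiveLocus hx) W hxW f₀ (hf₀ ▸ hf x)
          -- The other bad points are removed, so that away from `x` the prescribed generator is 1.
          let O' : X.Opens := O ⊓ ⟨((D.nonEffectiveLocus : Set X) \ {x})ᶜ,
            (hclosed _ Set.sdiff_subset).isOpen_compl⟩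
          have hO'O : O' ≤ O := inf_le_left
          refine ⟨O', ⟨hxO, fun h => h.2 rfl⟩, Unit, inferInstance, fun _ z =>
            algebraMap _ (TotalQuotient X z.1) (X.presheaf.germ O' z.1 z.2
              (X.presheaf.map (homOfLE (hO'O.trans hOW)).op f₀)),
            fun _ => isTotalQuotientSection_germ _, fun z => ?_⟩
          obtain ⟨z, hz⟩ := z
          rw [Set.range_const]
          simp only [TopCat.Presheaf.germ_res_apply]
          by_cases hzx : z = x
          · subst hzx
            rw [hf₀]
          · rw [hf1 z fun h => hz.2 ⟨h, hzx⟩, span_algebraMap_eq_one_of_isUnit isUnit_one,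
              span_algebraMap_eq_one_of_isUnit (hO z (hO'O hz) hzx)]
        · refine ⟨⟨(D.nonEffectiveLocus : Set X)ᶜ, (hclosed _ subset_rfl).isOpen_compl⟩, hx, Unit,
            inferInstance, fun _ _ => 1, fun _ => IsTotalQuotientSection.one _, fun z => ?_⟩
          rw [Set.range_const, hf1 z z.2, map_one]
      nondegenerate := fun η hη => by
        rw [span_algebraMap_eq_one_of_isUnit (isUnit_of_mem_nonZeroDivisors hη (hf η)),
          one_eq_top_of_mem_genericPoints hη] }
  have hFs : ∀ x, F.stalk x = Submodule.span _ {algebraMap _ (TotalQuotient X x) (f x)} :=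
    fun _ => rfl
  refine ⟨F, fun x => ?_, fun x => ?_, fun x => ?_⟩
  · rw [hFs, Submodule.span_singleton_le_iff_mem]
    exact Submodule.mem_one.2 ⟨_, rfl⟩
  · exact ⟨(isUnit_algebraMap_of_mem_nonZeroDivisors (hf x)).unit, by rw [hFs, IsUnit.unit_spec]⟩
  · rw [add_stalk, hFs, Submodule.mul_le]
    intro z hz w hw
    obtain ⟨r, rfl⟩ := Submodule.mem_span_singleton.1 hw
    rw [mul_smul_comm, mul_comm]
    exact Submodule.smul_mem _ _ (hfD x z hz)

end GeneralizedDivisor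

/-! ### Extension of fractional ideals along a ring homomorphism. -/

section Extend

variable {R S K L : Type*} [CommRing R] [CommRing S] [CommRing K] [CommRing L] [Algebra R K]
  [Algebra S L] {φ : R →+* S} {g : K →+* L}

/-- The submodule generated by the image of a submodule under a ring homomorphism. -/
def Submodule.extendAlong (S : Type*) [CommRing S] [Algebra S L] (g : K →+* L)
    (N : Submodule R K) : Submodule S L :=
  Submodule.span S (g '' N)

lemma Submodule.extendAlong_span (hg : ∀ r, g (algebraMap R K r) = algebraMap S L (φ r))
    (T : Set K) : (Submodule.span R T).extendAlong S g = Submodule.span S (g '' T) := by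
  refine le_antisymm (Submodule.span_le.2 ?_)
    (Submodule.span_mono (Set.image_mono Submodule.subset_span))
  rintro _ ⟨z, hz, rfl⟩
  induction hz using Submodule.span_induction with
  | mem z hz => exact Submodule.subset_span ⟨z, hz, rfl⟩
  | zero => rw [map_zero]; exact zero_mem _
  | add a b _ _ ha hb => rw [map_add]; exact add_mem ha hb
  | smul r a _ ha =>
    rw [Algebra.smul_def, map_mul, hg, ← Algebra.smul_def]
    exact Submodule.smul_mem _ _ ha

lemma Submodule.extendAlong_mul (hg : ∀ r, g (algebraMap R K r) = algebraMap S L (φ r))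
    (M N : Submodule R K) :
    (M * N).extendAlong S g = M.extendAlong S g * N.extendAlong S g := by
  conv_lhs => rw [← Submodule.span_eq M, ← Submodule.span_eq N, Submodule.span_mul_span]
  rw [extendAlong_span hg, Set.image_mul, extendAlong, extendAlong, Submodule.span_mul_span]

lemma Submodule.extendAlong_coeSubmodule
    (hg : ∀ r, g (algebraMap R K r) = algebraMap S L (φ r)) (I : Ideal R) :
    (IsLocalization.coeSubmodule K I).extendAlong S g =
      IsLocalization.coeSubmodule L (I.map φ) := by
  rw [Ideal.map, IsLocalization.coeSubmodule_span, ← Set.image_comp]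
  refine congrArg (Submodule.span S) ?_
  ext z
  simp only [Set.mem_image, SetLike.mem_coe, IsLocalization.mem_coeSubmodule, Function.comp_apply]
  constructor
  · rintro ⟨_, ⟨r, hr, rfl⟩, rfl⟩
    exact ⟨r, hr, (hg r).symm⟩
  · rintro ⟨r, hr, rfl⟩
    exact ⟨_, ⟨r, hr, rfl⟩, hg r⟩

lemma Submodule.extendAlong_span_singleton
    (hg : ∀ r, g (algebraMap R K r) = algebraMap S L (φ r)) (f : K) :
    (Submodule.span R {f}).extendAlong S g = Submodule.span S {g f} := by
  rw [extendAlong_span hg, Set.image_singleton]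

lemma Submodule.extendAlong_one (hg : ∀ r, g (algebraMap R K r) = algebraMap S L (φ r)) :
    (1 : Submodule R K).extendAlong S g = 1 := by
  rw [Submodule.one_eq_span, extendAlong_span_singleton hg, map_one, ← Submodule.one_eq_span]

lemma Submodule.extendAlong_mono {M N : Submodule R K} (h : M ≤ N) :
    M.extendAlong S g ≤ N.extendAlong S g :=
  Submodule.span_mono (Set.image_mono h)

/-- The inverse of an invertible ideal is generated by `f⁻¹`, which maps to the inverse of `g f`.
This is where the Cartier condition on the subtracted divisor enters. -/
lemma Submodule.extendAlong_one_div_span_singleton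
    (hg : ∀ r, g (algebraMap R K r) = algebraMap S L (φ r)) (f : Kˣ) :
    (1 / Submodule.span R {(f : K)}).extendAlong S g =
      1 / (Submodule.span R {(f : K)}).extendAlong S g := by
  rw [one_div_span_singleton_units, extendAlong_span_singleton hg, extendAlong_span_singleton hg]
  exact (one_div_span_singleton_units (Units.map (g : K →* L) f)).symm

end Extend

/-! ### Inverse images under flat morphisms. -/

namespace GeneralizedDivisor

variable {X Y : Scheme.{u}} (π : X ⟶ Y)

section Flat

variable [Flat π]

lemma nonZeroDivisors_le_comap_stalkMap (x : X) :
    nonZeroDivisors (Y.presheaf.stalk (π x)) ≤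
      (nonZeroDivisors (X.presheaf.stalk x)).comap (π.stalkMap x).hom := by
  intro b hb
  have hflat := Flat.stalkMap π x
  algebraize [(π.stalkMap x).hom]
  have h := Module.Flat.isSMulRegular_of_nonZeroDivisors (M := X.presheaf.stalk x) hb
  rw [Submonoid.mem_comap, mem_nonZeroDivisors_iff_right]
  intro z hz
  refine h ?_
  change b • z = b • 0
  rw [smul_zero, Algebra.smul_def, mul_comm]
  exact hz

/-- The map induced by a flat morphism on the stalks of the sheaves of total quotient rings. -/
noncomputable def totalQuotientMap (x : X) : TotalQuotient Y (π x) →+* TotalQuotient X x :=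
  IsLocalization.map (TotalQuotient X x) (π.stalkMap x).hom (nonZeroDivisors_le_comap_stalkMap π x)

lemma totalQuotientMap_algebraMap (x : X) (r : Y.presheaf.stalk (π x)) :
    totalQuotientMap π x (algebraMap _ _ r) = algebraMap _ _ ((π.stalkMap x).hom r) :=
  IsLocalization.map_eq _ r

lemma isTotalQuotientSection_totalQuotientMap {U : Y.Opens} {s : ∀ y : U, TotalQuotient Y y}
    (hs : IsTotalQuotientSection s) :
    IsTotalQuotientSection (U := π ⁻¹ᵁ U) (fun z => totalQuotientMap π z.1 (s ⟨π z.1, z.2⟩)) := by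
  intro x
  obtain ⟨V, hxV, hVU, a, b, h⟩ := hs ⟨π x.1, x.2⟩
  refine ⟨π ⁻¹ᵁ V, hxV, fun z hz => hVU hz, π.app V a, π.app V b, fun z hz => ?_⟩
  have hz' : π z ∈ V := hz
  obtain ⟨h1, h2⟩ := h (π z) hz'
  have h3 := congrArg (totalQuotientMap π z) h2
  rw [map_mul, totalQuotientMap_algebraMap, totalQuotientMap_algebraMap] at h3
  have h4 := nonZeroDivisors_le_comap_stalkMap π z h1
  have hg : ∀ c : Γ(Y, V), (π.stalkMap z).hom (Y.presheaf.germ V (π z) hz' c) =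
      X.presheaf.germ (π ⁻¹ᵁ V) z hz (π.app V c) := fun c =>
    Scheme.Hom.germ_stalkMap_apply π V z hz' c
  rw [Submonoid.mem_comap] at h4
  rw [hg] at h3 h4
  rw [hg] at h3
  exact ⟨h4, h3⟩

/-- The inverse image of a generalized divisor under a flat morphism. -/
noncomputable def pullback (D : GeneralizedDivisor Y) : GeneralizedDivisor X where
  stalk x := (D.stalk (π x)).extendAlong _ (totalQuotientMap π x)
  coherent x := by
    obtain ⟨U, hx, ι, _, s, hs, h⟩ := D.coherent (π x)
    refine ⟨π ⁻¹ᵁ U, hx, ι, inferInstance, fun i z => totalQuotientMap π z.1 (s i ⟨π z.1, z.2⟩),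
      fun i => isTotalQuotientSection_totalQuotientMap π (hs i), fun z => ?_⟩
    rw [h ⟨π z.1, z.2⟩, Submodule.extendAlong_span (totalQuotientMap_algebraMap π z.1),
      ← Set.range_comp]
    rfl
  nondegenerate η hη := by
    -- Generalizations lift along a flat morphism, so a proper generalization of `π η` would give
    -- one of `η`.
    have hgen : π η ∈ genericPoints Y := by
      obtain ⟨ξ, hξ, hξη⟩ := exists_genericPoint_specializes (π η)
      obtain ⟨η', hη', rfl⟩ := Flat.generalizingMap π hξη
      have : closure {η} = closure {η'} :=
        Set.Subset.antisymm (specializes_iff_closure_subset.1 hη')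
          (hη.2 isIrreducible_singleton.closure (specializes_iff_closure_subset.1 hη'))
      rwa [((specializes_iff_closure_subset.2 this.ge : η ⤳ η').antisymm hη').eq]
    rw [D.nondegenerate _ hgen, ← one_eq_top_of_mem_genericPoints hgen,
      Submodule.extendAlong_one (totalQuotientMap_algebraMap π η),
      one_eq_top_of_mem_genericPoints hη]

lemma pullback_stalk (D : GeneralizedDivisor Y) (x : X) :
    (pullback π D).stalk x = (D.stalk (π x)).extendAlong _ (totalQuotientMap π x) := rfl

end Flat

lemma IsEffective.coeSubmodule_idealStalk {E : GeneralizedDivisor X} (hE : E.IsEffective) (x : X) :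
    IsLocalization.coeSubmodule (TotalQuotient X x) (E.idealStalk x) = E.stalk x := by
  refine le_antisymm (Submodule.map_comap_le _ _) fun z hz => ?_
  obtain ⟨r, rfl⟩ := Submodule.mem_one.1 (hE x hz)
  exact ⟨r, hz, rfl⟩

lemma IsDifference.eq {D D' E F : GeneralizedDivisor X} (h : D.IsDifference E F)
    (h' : D'.IsDifference E F) : D = D' := by
  ext x : 2
  rw [h x, h' x]

variable [Flat π]

lemma isEffectiveInverseImage_iff {E : GeneralizedDivisor Y} (hE : E.IsEffective)
    (E' : GeneralizedDivisor X) : IsEffectiveInverseImage π E E' ↔ E' = pullback π E := by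
  have key : ∀ x, (pullback π E).stalk x = IsLocalization.coeSubmodule (TotalQuotient X x)
      ((E.idealStalk (π x)).map (π.stalkMap x).hom) := fun x => by
    rw [← Submodule.extendAlong_coeSubmodule (totalQuotientMap_algebraMap π x),
      hE.coeSubmodule_idealStalk, pullback_stalk]
  constructor
  · intro h
    ext x : 2
    rw [h x, key]
  · rintro rfl
    exact key

lemma IsCartier.pullback {F : GeneralizedDivisor Y} (hF : F.IsCartier) :
    (pullback π F).IsCartier := fun x => by
  obtain ⟨f, hf⟩ := hF (π x)
  refine ⟨Units.map (totalQuotientMap π x : _ →* _) f, ?_⟩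
  rw [pullback_stalk, hf, Submodule.extendAlong_span_singleton (totalQuotientMap_algebraMap π x)]
  rfl

lemma IsEffective.pullback {E : GeneralizedDivisor Y} (hE : E.IsEffective) :
    (pullback π E).IsEffective := fun x => by
  rw [← Submodule.extendAlong_one (totalQuotientMap_algebraMap π x)]
  exact Submodule.extendAlong_mono (hE (π x))

lemma IsDifference.pullback {D E F : GeneralizedDivisor Y} (hF : F.IsCartier)
    (h : D.IsDifference E F) :
    (pullback π D).IsDifference (pullback π E) (pullback π F) := fun x => by
  obtain ⟨f, hf⟩ := hF (π x)
  rw [pullback_stalk, h (π x), Submodule.extendAlong_mul (totalQuotientMap_algebraMap π x),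
    pullback_stalk, pullback_stalk, hf,
    Submodule.extendAlong_one_div_span_singleton (totalQuotientMap_algebraMap π x)]

/-- `pullback π D` does not mention a decomposition, and it carries every decomposition of `D` to
the one defining the inverse image, which in turn determines the divisor. -/
theorem isInverseImage_iff [IsCurve Y] (D : GeneralizedDivisor Y) (D' : GeneralizedDivisor X) :
    IsInverseImage π D D' ↔ D' = pullback π D := by
  constructor
  · rintro ⟨E, F, hE, hF, hFc, hD, E', F', hE', hF', hD'⟩
    rw [isEffectiveInverseImage_iff π hE] at hE'
    rw [isEffectiveInverseImage_iff π hF] at hF'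
    subst hE' hF'
    exact hD'.eq (hD.pullback π hFc)
  · rintro rfl
    obtain ⟨F, hF, hFc, hE⟩ := exists_isCartier_add_isEffective D
    exact ⟨D + F, F, hE, hF, hFc, hFc.isDifference_add D, _, _,
      (isEffectiveInverseImage_iff π hE _).2 rfl, (isEffectiveInverseImage_iff π hF _).2 rfl,
      (hFc.isDifference_add D).pullback π hFc⟩

end GeneralizedDivisor

/-! ### Quasi-coherence of the ideal sheaf of an effective divisor. -/

namespace GeneralizedDivisor

variable {X : Scheme.{u}}

lemma mem_idealSections {D : GeneralizedDivisor X} {U : X.Opens} {b : Γ(X, U)} :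
    b ∈ D.idealSections U ↔
      ∀ (x : X) (hx : x ∈ U), X.presheaf.germ U x hx b ∈ D.idealStalk x := by
  simp only [idealSections, Ideal.mem_iInf, Ideal.mem_comap, Subtype.forall]

lemma idealStalk_eq_span {D : GeneralizedDivisor X} {x : X} {ι : Type*}
    {c : ι → X.presheaf.stalk x}
    (h : D.stalk x = Submodule.span _ (Set.range fun i => algebraMap _ (TotalQuotient X x) (c i))) :
    D.idealStalk x = Ideal.span (Set.range c) := by
  have h2 : D.stalk x = Submodule.map
      (Algebra.linearMap (X.presheaf.stalk x) (TotalQuotient X x)) (Ideal.span (Set.range c)) := by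
    rw [h, Ideal.span, Submodule.map_span, ← Set.range_comp]
    rfl
  rw [idealStalk, h2]
  exact Submodule.comap_map_eq_of_injective (IsFractionRing.injective _ _) _

/-- Local generators, multiplied by powers of `h`, extend to sections over `U`. Those powers are
units on the basic open set, so the extended sections generate the same stalks there. -/
lemma exists_basicOpen_idealStalk_eq_map {E : GeneralizedDivisor X} (hE : E.IsEffective)
    {U : X.Opens} (hU : IsAffineOpen U) {x : X} (hx : x ∈ U) :
    ∃ h : Γ(X, U), x ∈ X.basicOpen h ∧ ∃ C : Ideal Γ(X, U), ∀ (w : X) (hw : w ∈ U),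
      w ∈ X.basicOpen h → E.idealStalk w = C.map (X.presheaf.germ U w hw).hom := by
  obtain ⟨V, hxV, ι, _, c, hc⟩ := E.exists_generators x (hE x)
  obtain ⟨h, hhV, hxh⟩ := hU.exists_basicOpen_le ⟨x, hxV⟩ hx
  have := hU.isLocalization_basicOpen h
  have hs : ∀ i, ∃ a : Γ(X, U), ∃ k : ℕ, X.presheaf.map (homOfLE hhV).op (c i) *
      X.presheaf.map (homOfLE (X.basicOpen_le h)).op h ^ k =
        X.presheaf.map (homOfLE (X.basicOpen_le h)).op a := by
    intro i
    obtain ⟨⟨a, ⟨_, k, rfl⟩⟩, ha⟩ := IsLocalization.surj (Submonoid.powers h)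
      (X.presheaf.map (homOfLE hhV).op (c i) : Γ(X, X.basicOpen h))
    refine ⟨a, k, ?_⟩
    rw [← map_pow]
    exact ha
  choose a k ha using hs
  refine ⟨h, hxh, Ideal.span (Set.range a), fun w hw hwh => ?_⟩
  rw [idealStalk_eq_span (hc w (hhV hwh)), Ideal.map_span, ← Set.range_comp]
  have hu : IsUnit (X.presheaf.germ U w hw h) := (X.mem_basicOpen h w hw).1 hwh
  have hac : ∀ i, X.presheaf.germ V w (hhV hwh) (c i) * X.presheaf.germ U w hw h ^ k i =
      X.presheaf.germ U w hw (a i) := fun i => by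
    have := congrArg (X.presheaf.germ (X.basicOpen h) w hwh) (ha i)
    simpa only [map_mul, map_pow, TopCat.Presheaf.germ_res_apply] using this
  refine le_antisymm (Ideal.span_le.2 ?_) (Ideal.span_le.2 ?_)
  · rintro _ ⟨i, rfl⟩
    rw [SetLike.mem_coe, ← Ideal.mul_unit_mem_iff_mem _ (hu.pow (k i)), hac]
    exact Ideal.subset_span ⟨i, rfl⟩
  · rintro _ ⟨i, rfl⟩
    refine SetLike.mem_coe.2 ?_
    rw [Function.comp_apply]
    erw [← hac]
    exact Ideal.mul_mem_right _ _ (Ideal.subset_span ⟨i, rfl⟩)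

/-- The ideal sheaf of an effective generalized divisor is quasi-coherent. -/
lemma map_germ_idealSections {E : GeneralizedDivisor X} (hE : E.IsEffective)
    {U : X.Opens} (hU : IsAffineOpen U) {x : X} (hx : x ∈ U) :
    (E.idealSections U).map (X.presheaf.germ U x hx).hom = E.idealStalk x := by
  refine le_antisymm (Ideal.map_le_iff_le_comap.2 fun b hb => mem_idealSections.1 hb x hx) ?_
  obtain ⟨h, hxh, C, hC⟩ := exists_basicOpen_idealStalk_eq_map hE hU hx
  rw [hC x hx hxh, Ideal.map_le_iff_le_comap]
  intro c hc
  -- `c` lies in the ideal only over the basic open set of `h`; a power of `h`, uniform by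
  -- compactness, puts it in the ideal at all points of `U`. Since `h` is a unit at `x`, this
  -- suffices.
  have key : ∃ N : ℕ, ∀ w ∈ (U : Set X), ∀ hw : w ∈ U,
      X.presheaf.germ U w hw (h ^ N * c) ∈ E.idealStalk w := by
    refine hU.isCompact.induction_on (p := fun S => ∃ N : ℕ, ∀ w ∈ S, ∀ hw : w ∈ U,
      X.presheaf.germ U w hw (h ^ N * c) ∈ E.idealStalk w) ⟨0, fun w hw => absurd hw id⟩ ?_ ?_ ?_
    · rintro S T hST ⟨N, hN⟩
      exact ⟨N, fun w hw => hN w (hST hw)⟩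
    · rintro S T ⟨N, hN⟩ ⟨M, hM⟩
      refine ⟨N + M, fun w hw hwU => ?_⟩
      rcases hw with hw | hw
      · rw [add_comm, pow_add, mul_assoc, map_mul]
        exact Ideal.mul_mem_left _ _ (hN w hw hwU)
      · rw [pow_add, mul_assoc, map_mul]
        exact Ideal.mul_mem_left _ _ (hM w hw hwU)
    -- On the locus where `h * h'` is invertible both local descriptions hold, so some `(h * h') ^ N
    -- * c` lies in `C'`. Near `z` the factor `h' ^ N` is a unit and can be dropped.
    · intro z hz
      obtain ⟨h', hzh', C', hC'⟩ := exists_basicOpen_idealStalk_eq_map hE hU hz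
      let W := X.basicOpen (h * h')
      have := hU.isLocalization_basicOpen (h * h')
      have hmem : X.presheaf.map (homOfLE (X.basicOpen_le (h * h'))).op c ∈
          C'.map (X.presheaf.map (homOfLE (X.basicOpen_le (h * h'))).op).hom := by
        rw [(hU.basicOpen (h * h')).mem_ideal_iff]
        intro w hw
        have hwU : w ∈ U := X.basicOpen_le _ hw
        have hw2 := hw
        rw [X.basicOpen_mul] at hw2
        rw [Ideal.map_map, ← CommRingCat.hom_comp, TopCat.Presheaf.germ_res,
          TopCat.Presheaf.germ_res_apply, ← hC' w hwU hw2.2, hC w hwU hw2.1]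
        exact Ideal.mem_map_of_mem _ hc
      obtain ⟨_, ⟨N, rfl⟩, hN⟩ := (IsLocalization.algebraMap_mem_map_algebraMap_iff
        (Submonoid.powers (h * h')) Γ(X, X.basicOpen (h * h')) C' c).1 hmem
      refine ⟨X.basicOpen h', mem_nhdsWithin_of_mem_nhds
        ((X.basicOpen h').isOpen.mem_nhds hzh'), N, fun w hw hwU => ?_⟩
      rw [hC' w hwU hw]
      have hu : IsUnit (X.presheaf.germ U w hwU h') := (X.mem_basicOpen h' w hwU).1 hw
      rw [← Ideal.unit_mul_mem_iff_mem _ (hu.pow N), ← map_pow, ← map_mul, ← mul_assoc,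
        ← mul_pow, mul_comm h']
      exact Ideal.mem_map_of_mem _ hN
  obtain ⟨N, hN⟩ := key
  have hu : IsUnit (X.presheaf.germ U x hx h) := (X.mem_basicOpen h x hx).1 hxh
  rw [Ideal.mem_comap]
  refine (Ideal.unit_mul_mem_iff_mem _ (hu.pow N)).1 ?_
  have := Ideal.mem_map_of_mem (X.presheaf.germ U x hx).hom
    (mem_idealSections.2 fun w hw => hN w hw hw)
  rwa [map_mul, map_pow] at this

end GeneralizedDivisor

/-! ### Primes in the fibres of a finite morphism. -/

namespace AlgebraicGeometry.IsAffineOpen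

variable {X Y : Scheme.{u}}

lemma isUnit_germ_iff {U : X.Opens} (hU : IsAffineOpen U) {x : X} (hx : x ∈ U) (t : Γ(X, U)) :
    IsUnit (X.presheaf.germ U x hx t) ↔ t ∉ (hU.primeIdealOf ⟨x, hx⟩).asIdeal := by
  let := X.presheaf.algebra_section_stalk ⟨x, hx⟩
  have := hU.isLocalization_stalk ⟨x, hx⟩
  exact IsLocalization.AtPrime.isUnit_to_map_iff (X.presheaf.stalk x)
    (hU.primeIdealOf ⟨x, hx⟩).asIdeal t

lemma exists_primeIdealOf_eq {U : X.Opens} (hU : IsAffineOpen U) (q : PrimeSpectrum Γ(X, U)) :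
    ∃ (x : X) (hx : x ∈ U), hU.primeIdealOf ⟨x, hx⟩ = q := by
  have hx : hU.fromSpec q ∈ U := by
    have : hU.fromSpec q ∈ Set.range hU.fromSpec := ⟨q, rfl⟩
    rwa [hU.range_fromSpec] at this
  exact ⟨_, hx, hU.fromSpec.isOpenEmbedding.injective (hU.fromSpec_primeIdealOf ⟨_, hx⟩)⟩

lemma comap_primeIdealOf_app {V : Y.Opens} (hV : IsAffineOpen V) (π : X ⟶ Y) [IsAffineHom π]
    {x : X} (hx : x ∈ π ⁻¹ᵁ V) :
    ((hV.preimage π).primeIdealOf ⟨x, hx⟩).comap (π.app V).hom = hV.primeIdealOf ⟨π x, hx⟩ := by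
  have := comap_primeIdealOf_appLE (f := π) V hV (π ⁻¹ᵁ V) (hV.preimage π) le_rfl hx
  rwa [Scheme.Hom.appLE_eq_app] at this

lemma primeIdealOf_injective {U : X.Opens} (hU : IsAffineOpen U) {x x' : X} {hx : x ∈ U}
    {hx' : x' ∈ U} (h : hU.primeIdealOf ⟨x, hx⟩ = hU.primeIdealOf ⟨x', hx'⟩) : x = x' := by
  have := congrArg hU.fromSpec h
  rwa [hU.fromSpec_primeIdealOf, hU.fromSpec_primeIdealOf] at this

lemma isIntegral_app {V : Y.Opens} (hV : IsAffineOpen V) (π : X ⟶ Y) [IsFinite π] :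
    letI := (π.app V).hom.toAlgebra
    Algebra.IsIntegral Γ(Y, V) Γ(X, π ⁻¹ᵁ V) :=
  letI := (π.app V).hom.toAlgebra
  ⟨π.isIntegral_app V hV⟩

/-- Membership in an ideal can be checked in the stalks at the points of a fibre, up to a function
on the base which is invertible at the base point. -/
lemma exists_app_mul_mem {V : Y.Opens} (hV : IsAffineOpen V) (π : X ⟶ Y) [IsFinite π] {y : Y}
    (hy : y ∈ V) (b : Γ(X, π ⁻¹ᵁ V)) (I : Ideal Γ(X, π ⁻¹ᵁ V))
    (h : ∀ (x : X) (hx : x ∈ π ⁻¹ᵁ V), π x = y → X.presheaf.germ _ x hx b ∈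
      I.map (X.presheaf.germ _ x hx).hom) :
    ∃ s : Γ(Y, V), IsUnit (Y.presheaf.germ V y hy s) ∧ π.app V s * b ∈ I := by
  by_contra! hs
  let := (π.app V).hom.toAlgebra
  have := hV.isIntegral_app π
  -- If no such `s` exists, the ideal `(I : b)` contracts into the prime of `y`. Lying over gives a
  -- prime containing `(I : b)` above it, that is, a point of the fibre, and there the hypothesis
  -- fails.
  have hle : (I.colon {b}).comap (algebraMap Γ(Y, V) Γ(X, π ⁻¹ᵁ V)) ≤
      (hV.primeIdealOf ⟨y, hy⟩).asIdeal := by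
    intro s hsI
    by_contra hsp
    exact hs s ((hV.isUnit_germ_iff hy s).2 hsp) (Submodule.mem_colon_singleton.1 hsI)
  obtain ⟨Q, hQI, hQ, hQp⟩ := Ideal.exists_ideal_over_prime_of_isIntegral _ _ hle
  obtain ⟨x, hx, hxQ⟩ := (hV.preimage π).exists_primeIdealOf_eq ⟨Q, hQ⟩
  have hpi : π x = y := by
    have h1 := hV.comap_primeIdealOf_app π hx
    rw [hxQ] at h1
    exact hV.primeIdealOf_injective (h1.symm.trans (PrimeSpectrum.ext hQp))
  obtain ⟨t, ht, htb⟩ := (hV.preimage π).exists_mul_mem hx (h x hx hpi)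
  rw [(hV.preimage π).isUnit_germ_iff hx, hxQ] at ht
  exact ht (hQI (Submodule.mem_colon_singleton.2 htb))

end AlgebraicGeometry.IsAffineOpen

/-! ### Principal generators of Cartier divisors near a fibre. -/

namespace GeneralizedDivisor

variable {X Y : Scheme.{u}}

lemma IsCartier.exists_idealStalk_eq_span {F : GeneralizedDivisor X} (hF : F.IsCartier)
    (hFe : F.IsEffective) (x : X) : ∃ f ∈ nonZeroDivisors (X.presheaf.stalk x),
      F.idealStalk x = Ideal.span {f} ∧
        F.stalk x = Submodule.span _ {algebraMap _ (TotalQuotient X x) f} := by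
  obtain ⟨g, hg⟩ := hF x
  obtain ⟨f, hf⟩ := Submodule.mem_one.1 (hFe x (hg ▸ Submodule.mem_span_singleton_self _))
  rw [← hf] at hg
  refine ⟨f, ?_, ?_, hg⟩
  · have hu : IsUnit (algebraMap _ (TotalQuotient X x) f) := hf ▸ g.isUnit
    rw [mem_nonZeroDivisors_iff_right]
    intro a ha
    apply IsFractionRing.injective _ (TotalQuotient X x)
    rw [map_zero, ← hu.mul_left_eq_zero, ← map_mul, ha, map_zero]
  · have := idealStalk_eq_span (D := F) (x := x) (c := fun _ : Unit => f)
      (by rw [Set.range_const, hg])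
    rwa [Set.range_const] at this

/-- An effective Cartier divisor is generated by a single function near a fibre of a finite
morphism. -/
lemma IsCartier.exists_generator_fiber {F : GeneralizedDivisor X} (hF : F.IsCartier)
    (hFe : F.IsEffective) (π : X ⟶ Y) [IsFinite π] {V : Y.Opens} (hV : IsAffineOpen V) {y : Y}
    (hy : y ∈ V) : ∃ f : Γ(X, π ⁻¹ᵁ V), ∀ (x : X) (hx : x ∈ π ⁻¹ᵁ V), π x = y →
      X.presheaf.germ _ x hx f ∈ nonZeroDivisors (X.presheaf.stalk x) ∧
      F.idealStalk x = Ideal.span {X.presheaf.germ _ x hx f} := by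
  have hU := hV.preimage π
  have hmem : ∀ x : (π ⁻¹' {y} : Set X), x.1 ∈ π ⁻¹ᵁ V := fun x => by
    have : π x.1 = y := x.2
    change π x.1 ∈ V
    rwa [this]
  have hfin : Finite (π ⁻¹' {y} : Set X) := π.finite_preimage_singleton y
  let P : (π ⁻¹' {y} : Set X) → Ideal Γ(X, π ⁻¹ᵁ V) := fun x =>
    (hU.primeIdealOf ⟨x.1, hmem x⟩).asIdeal
  have hP : ∀ x, (P x).IsPrime := fun x => (hU.primeIdealOf ⟨x.1, hmem x⟩).isPrime
  -- Primes of an integral extension over the same prime are incomparable, as required for choosing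
  -- one generator at all fibre points.
  have hinc : ∀ x x', P x ≤ P x' → x = x' := by
    intro x x' hle
    have hcomap : ∀ x, (P x).comap (π.app V).hom = (hV.primeIdealOf ⟨y, hy⟩).asIdeal := by
      intro x
      have h1 := congrArg PrimeSpectrum.asIdeal (hV.comap_primeIdealOf_app π (hmem x))
      have h2 : (⟨π x.1, hmem x⟩ : V) = ⟨y, hy⟩ := Subtype.ext x.2
      rw [h2] at h1
      exact h1
    rcases hle.lt_or_eq with hlt | heq
    · let := (π.app V).hom.toAlgebra
      have := hV.isIntegral_app π
      have hlt' := Ideal.IsIntegral.comap_lt_comap (R := Γ(Y, V)) hlt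
      exact absurd ((hcomap x).trans (hcomap x').symm) hlt'.ne
    · exact Subtype.ext (hU.primeIdealOf_injective (PrimeSpectrum.ext heq))
  -- By quasi-coherence a generator of the stalk is, up to a unit, the germ of a section of the
  -- ideal over the whole preimage.
  have hloc : ∀ x, ∃ c ∈ F.idealSections (π ⁻¹ᵁ V), ∀ b ∈ F.idealSections (π ⁻¹ᵁ V),
      ∃ t ∉ P x, t * b ∈ Ideal.span {c} := by
    intro x
    obtain ⟨φ, hφ, hφF, -⟩ := hF.exists_idealStalk_eq_span hFe x.1
    let := X.presheaf.algebra_section_stalk ⟨x.1, hmem x⟩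
    have := hU.isLocalization_stalk ⟨x.1, hmem x⟩
    have hφI : φ ∈ (F.idealSections (π ⁻¹ᵁ V)).map
        (algebraMap Γ(X, π ⁻¹ᵁ V) (X.presheaf.stalk x.1)) := by
      have h1 := map_germ_idealSections hFe hU (hmem x)
      rw [hφF] at h1
      exact h1.ge (Ideal.mem_span_singleton_self φ)
    obtain ⟨⟨⟨c, hc⟩, t⟩, hct⟩ := (IsLocalization.mem_map_algebraMap_iff (P x).primeCompl
      (X.presheaf.stalk x.1)).1 hφI
    refine ⟨c, hc, fun b hb => ?_⟩
    have hb2 := mem_idealSections.1 hb x.1 (hmem x)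
    have ht : IsUnit (X.presheaf.germ _ x.1 (hmem x) t.1) := (hU.isUnit_germ_iff _ _).2 t.2
    have hct' : φ * X.presheaf.germ _ x.1 (hmem x) t.1 = X.presheaf.germ _ x.1 (hmem x) c := hct
    have hb3 : X.presheaf.germ _ x.1 (hmem x) b ∈
        (Ideal.span {c}).map (X.presheaf.germ _ x.1 (hmem x)).hom := by
      rw [Ideal.map_span, Set.image_singleton]
      refine (Ideal.span_singleton_le_span_singleton.2 ?_) (hφF ▸ hb2)
      change X.presheaf.germ _ x.1 (hmem x) c ∣ φ
      rw [← hct', ht.mul_right_dvd]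
    obtain ⟨s, hs, hsb⟩ := hU.exists_mul_mem (hmem x) hb3
    exact ⟨s, (hU.isUnit_germ_iff _ _).1 hs, hsb⟩
  obtain ⟨f, hfI, hf⟩ := Ideal.exists_mem_generating_at_primes P hinc _ hloc
  refine ⟨f, fun x hx hxy => ?_⟩
  have hspan : F.idealStalk x = Ideal.span {X.presheaf.germ _ x hx f} := by
    rw [← map_germ_idealSections hFe hU hx]
    refine le_antisymm (Ideal.map_le_iff_le_comap.2 fun b hb => ?_)
      ((Ideal.span_singleton_le_iff_mem _).2 (Ideal.mem_map_of_mem _ hfI))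
    obtain ⟨t, ht, htb⟩ := hf ⟨x, hxy⟩ b hb
    have ht' : IsUnit (X.presheaf.germ _ x hx t) := (hU.isUnit_germ_iff hx t).2 ht
    have h1 := Ideal.mem_map_of_mem (X.presheaf.germ _ x hx).hom htb
    rw [Ideal.map_span, Set.image_singleton, map_mul] at h1
    exact (Ideal.unit_mul_mem_iff_mem _ ht').1 h1
  refine ⟨?_, hspan⟩
  obtain ⟨φ, hφ, hφF, -⟩ := hF.exists_idealStalk_eq_span hFe x
  have h1 : φ ∈ Ideal.span {X.presheaf.germ _ x hx f} := by
    rw [← hspan, hφF]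
    exact Ideal.mem_span_singleton_self φ
  obtain ⟨r, hr⟩ := Ideal.mem_span_singleton'.1 h1
  rw [← hr] at hφ
  exact (mul_mem_nonZeroDivisors.1 hφ).2

end GeneralizedDivisor

/-! ### Localizing the Fitting ideal comparison at a prime of the base. -/

section LocalFitting

variable {A B : Type*} [CommRing A] [CommRing B] [Algebra A B]

lemma Submodule.localized'_restrictScalars_ideal (S : Submonoid A) {A' B' : Type*} [CommRing A']
    [CommRing B'] [Algebra A A'] [Algebra B B'] [Algebra A' B'] [Algebra A B']
    [IsScalarTower A A' B'] [IsScalarTower A B B'] [IsLocalization S A']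
    [IsLocalizedModule S (IsScalarTower.toAlgHom A B B').toLinearMap] (I : Ideal B) :
    (I.restrictScalars A).localized' A' S (IsScalarTower.toAlgHom A B B').toLinearMap =
      (I.map (algebraMap B B')).restrictScalars A' := by
  have := (isLocalizedModule_iff_isLocalization (S := S) (A := B) (Aₛ := B')).1 inferInstance
  ext z
  rw [Submodule.mem_localized', Submodule.restrictScalars_mem,
    IsLocalization.mem_map_algebraMap_iff (Algebra.algebraMapSubmonoid B S) B']
  constructor
  · rintro ⟨m, hm, s, rfl⟩
    refine ⟨⟨⟨m, hm⟩, ⟨algebraMap A B s, s, s.2, rfl⟩⟩, ?_⟩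
    have := IsLocalizedModule.mk'_cancel' (IsScalarTower.toAlgHom A B B').toLinearMap m s
    rw [Submonoid.smul_def, Algebra.smul_def] at this
    rw [mul_comm, ← IsScalarTower.algebraMap_apply]
    exact this
  · rintro ⟨⟨⟨m, hm⟩, ⟨_, s, hs, rfl⟩⟩, h⟩
    refine ⟨m, hm, ⟨s, hs⟩, ?_⟩
    rw [IsLocalizedModule.mk'_eq_iff, Submonoid.smul_def, Algebra.smul_def, mul_comm,
      IsScalarTower.algebraMap_apply A B B']
    exact h.symm

lemma fittingIdeal_quotient_map_localization (S : Submonoid A) (A' : Type*) {B' : Type*}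
    [CommRing A'] [CommRing B'] [Algebra A A'] [Algebra B B'] [Algebra A' B'] [Algebra A B']
    [IsScalarTower A A' B'] [IsScalarTower A B B'] [IsLocalization S A']
    [IsLocalizedModule S (IsScalarTower.toAlgHom A B B').toLinearMap] [Module.Finite A B]
    (I : Ideal B) :
    (fittingIdeal A (B ⧸ I)).map (algebraMap A A') =
      fittingIdeal A' (B' ⧸ I.map (algebraMap B B')) := by
  rw [fittingIdeal_restrictScalars, fittingIdeal_restrictScalars,
    ← Submodule.localized'_restrictScalars_ideal S]
  exact fittingIdeal_map_isLocalizedModule S A'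
    ((I.restrictScalars A).toLocalizedQuotient' A' S (IsScalarTower.toAlgHom A B B').toLinearMap)

/-- Comparison of the Fitting ideals, localized at a prime `p` of `A`, of the quotients by the
ideals `I` and `L` of a finite flat algebra, if `L` is locally generated by the nonzerodivisor `f`
and `g I = f J` locally. -/
lemma exists_span_pow_mul_fittingIdeal_map_eq [IsNoetherianRing A] [Module.Finite A B]
    [Module.Flat A B] (p : PrimeSpectrum A) (n : ℕ) (hn : Module.rankAtStalk (R := A) B p = n)
    (A' : Type*) [CommRing A'] [Algebra A A'] [IsLocalization.AtPrime A' p.asIdeal]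
    (g : A) (f : B) (I L : Ideal B) (J : Ideal A)
    (hL : ∀ b ∈ L, ∃ s ∉ p.asIdeal, algebraMap A B s * b ∈ Ideal.span {f})
    (hf : ∃ s ∉ p.asIdeal, algebraMap A B s * f ∈ L)
    (hf0 : ∀ b, b * f = 0 → ∃ s ∉ p.asIdeal, algebraMap A B s * b = 0)
    (hI : ∀ b ∈ Ideal.span {algebraMap A B g} * I, ∃ s ∉ p.asIdeal,
      algebraMap A B s * b ∈ Ideal.span {f} * J.map (algebraMap A B))
    (hJ : ∀ b ∈ Ideal.span {f} * J.map (algebraMap A B), ∃ s ∉ p.asIdeal,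
      algebraMap A B s * b ∈ Ideal.span {algebraMap A B g} * I) :
    ∃ ν ∈ nonZeroDivisors A', (fittingIdeal A (B ⧸ L)).map (algebraMap A A') = Ideal.span {ν} ∧
      Ideal.span {algebraMap A A' g ^ n} * (fittingIdeal A (B ⧸ I)).map (algebraMap A A') =
        Ideal.span {ν} * (J.map (algebraMap A A')) ^ n := by
  let S := p.asIdeal.primeCompl
  -- `B` is localized at the complement of the prime of the base. The result is finite and flat over
  -- the local ring `A'`, hence free of rank `n`, and every hypothesis "up to some `s ∉ p`" becomes
  -- exact.
  let B' := Localization (Algebra.algebraMapSubmonoid B S)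
  let : Algebra A' B' := localizationAlgebra S B
  have : IsScalarTower A A' B' := isScalarTower_localizationAlgebra S B
  have hloc : IsLocalizedModule S (IsScalarTower.toAlgHom A B B').toLinearMap :=
    (isLocalizedModule_iff_isLocalization (S := S) (A := B) (Aₛ := B')).2 inferInstance
  have : IsLocalRing A' := IsLocalization.AtPrime.isLocalRing A' p.asIdeal
  have : IsNoetherianRing A' := IsLocalization.isNoetherianRing S A' inferInstance
  have hfin : Module.Finite A' B' :=
    Module.Finite.of_isLocalizedModule S (IsScalarTower.toAlgHom A B B').toLinearMap
  have hflat : Module.Flat A' B' :=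
    Module.Flat.of_isLocalizedModule A' S (IsScalarTower.toAlgHom A B B').toLinearMap
  have hfree : Module.Free A' B' := Module.free_of_flat_of_isLocalRing
  have hrank : Module.finrank A' B' = n := by
    have h1 := Module.rankAtStalk_isBaseChange (IsLocalizedModule.isBaseChange S A'
      (IsScalarTower.toAlgHom A B B').toLinearMap) (IsLocalRing.closedPoint A')
    have h2 : PrimeSpectrum.comap (algebraMap A A') (IsLocalRing.closedPoint A') = p :=
      PrimeSpectrum.ext (IsLocalization.AtPrime.under_maximalIdeal A' p.asIdeal)
    rw [h2, hn, Module.rankAtStalk_eq_finrank_of_free] at h1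
    exact h1
  let b : Module.Basis (Fin n) A' B' := Module.finBasisOfFinrankEq A' B' hrank
  have hunit : ∀ s ∉ p.asIdeal, IsUnit (algebraMap B B' (algebraMap A B s)) := fun s hs =>
    IsLocalization.map_units B'
      (⟨algebraMap A B s, s, hs, rfl⟩ : Algebra.algebraMapSubmonoid B S)
  have hle : ∀ M N : Ideal B, (∀ b ∈ M, ∃ s ∉ p.asIdeal, algebraMap A B s * b ∈ N) →
      M.map (algebraMap B B') ≤ N.map (algebraMap B B') := by
    intro M N h
    rw [Ideal.map_le_iff_le_comap]
    intro b hb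
    obtain ⟨s, hs, hsb⟩ := h b hb
    rw [Ideal.mem_comap, ← Ideal.unit_mul_mem_iff_mem _ (hunit s hs), ← map_mul]
    exact Ideal.mem_map_of_mem _ hsb
  have hL' : L.map (algebraMap B B') = Ideal.span {algebraMap B B' f} := by
    rw [← Set.image_singleton, ← Ideal.map_span]
    refine le_antisymm (hle _ _ hL) (hle _ _ fun b hb => ?_)
    obtain ⟨r, rfl⟩ := Ideal.mem_span_singleton'.1 hb
    obtain ⟨s, hs, hsf⟩ := hf
    exact ⟨s, hs, by rw [mul_left_comm]; exact Ideal.mul_mem_left _ _ hsf⟩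
  have hJmap : (J.map (algebraMap A B)).map (algebraMap B B') =
      (J.map (algebraMap A A')).map (algebraMap A' B') := by
    rw [Ideal.map_map, Ideal.map_map, ← IsScalarTower.algebraMap_eq, ← IsScalarTower.algebraMap_eq]
  have hI' := le_antisymm (hle _ _ hI) (hle _ _ hJ)
  rw [Ideal.map_mul, Ideal.map_mul, Ideal.map_span, Ideal.map_span, Set.image_singleton,
    Set.image_singleton, hJmap, ← IsScalarTower.algebraMap_apply,
    IsScalarTower.algebraMap_apply A A' B'] at hI'
  refine ⟨Algebra.norm A' (algebraMap B B' f), ?_, ?_, ?_⟩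
  · rw [Algebra.norm_apply]
    refine LinearMap.det_mem_nonZeroDivisors_of_injective b _ ?_
    rw [← LinearMap.ker_eq_bot, LinearMap.ker_eq_bot']
    intro z hz
    obtain ⟨⟨c, t⟩, hct⟩ := IsLocalization.surj (Algebra.algebraMapSubmonoid B S) z
    have h0 : algebraMap B B' (c * f) = 0 := by
      have hz' : algebraMap B B' f * z = 0 := hz
      rw [map_mul, ← hct, mul_right_comm, mul_comm z, hz', zero_mul]
    obtain ⟨⟨_, s, hs, rfl⟩, hsc⟩ :=
      (IsLocalization.map_eq_zero_iff (Algebra.algebraMapSubmonoid B S) B' _).1 h0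
    obtain ⟨s', hs', hsc'⟩ := hf0 (algebraMap A B s * c) (by rw [mul_assoc]; exact hsc)
    have h1 := congrArg (algebraMap B B') hsc'
    rw [map_mul, map_mul, map_zero, (hunit s' hs').mul_right_eq_zero,
      (hunit s hs).mul_right_eq_zero, ← hct,
      (IsLocalization.map_units B' t).mul_left_eq_zero] at h1
    exact h1
  · rw [fittingIdeal_quotient_map_localization S A' (B' := B'), hL',
      fittingIdeal_quotient_span_singleton b]
  · rw [fittingIdeal_quotient_map_localization S A' (B' := B')]
    exact span_pow_mul_fittingIdeal_eq b _ _ _ _ hI'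

end LocalFitting

lemma IsLocalization.coeSubmodule_pow {R K : Type*} [CommRing R] [CommRing K] [Algebra R K]
    (I : Ideal R) (n : ℕ) : coeSubmodule K (I ^ n) = coeSubmodule K I ^ n := by
  induction n with
  | zero => rw [pow_zero, pow_zero, Ideal.one_eq_top, coeSubmodule_top]
  | succ n ih => rw [pow_succ, pow_succ, coeSubmodule_mul, ih]

lemma fittingIdeal_eq_top_of_subsingleton (R M : Type*) [CommRing R] [AddCommGroup M] [Module R M]
    [Subsingleton M] : fittingIdeal R M = ⊤ := by
  rw [Ideal.eq_top_iff_one]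
  exact Ideal.subset_span ⟨0, 0, 0, Subsingleton.elim _ _, fun i => i.elim0,
    Matrix.det_isEmpty.symm⟩

/-! ### The degree of the morphism as the rank of an algebra. -/

namespace AlgebraicGeometry.IsAffineOpen

variable {X Y : Scheme.{u}}

lemma isPullback_fromSpec_app {V : Y.Opens} (hV : IsAffineOpen V) (π : X ⟶ Y) [IsAffineHom π] :
    IsPullback (hV.preimage π).fromSpec (Spec.map (π.app V)) π hV.fromSpec := by
  have hU := hV.preimage π
  refine IsPullback.of_iso (isPullback_morphismRestrict π V).flip hU.isoSpec (Iso.refl _)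
    hV.isoSpec (Iso.refl _) ?_ ?_ ?_ ?_
  · simp
  · rw [← cancel_mono hV.fromSpec, Category.assoc, Category.assoc, isoSpec_hom_fromSpec]
    rw [← Scheme.Hom.appLE_eq_app, hV.SpecMap_appLE_fromSpec π hU le_rfl, isoSpec_hom_fromSpec_assoc]
    simp
  · simp
  · simp

/-- The degree is invariant under base change to the spectrum of the sections over `V`, where it is
the rank of the algebra of sections. -/
lemma rankAtStalk_app {V : Y.Opens} (hV : IsAffineOpen V) (π : X ⟶ Y) [IsFinite π] [Flat π] {y : Y}
    (hy : y ∈ V) :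
    letI := (π.app V).hom.toAlgebra
    Module.rankAtStalk (R := Γ(Y, V)) Γ(X, π ⁻¹ᵁ V) (hV.primeIdealOf ⟨y, hy⟩) = π.finrank y := by
  have hflat := π.flat_appLE hV (hV.preimage π) le_rfl
  rw [Scheme.Hom.appLE_eq_app] at hflat
  have h1 := Scheme.Hom.finrank_of_isPullback _ _ _ _ (hV.isPullback_fromSpec_app π)
    (hV.primeIdealOf ⟨y, hy⟩)
  rw [Scheme.Hom.finrank_SpecMap_eq_finrank (π.finite_app V hV) hflat,
    hV.fromSpec_primeIdealOf] at h1
  exact h1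

end AlgebraicGeometry.IsAffineOpen

/-! ### Direct images of pulled back divisors. -/

namespace GeneralizedDivisor

variable {X Y : Scheme.{u}} (π : X ⟶ Y)

lemma nsmul_stalk (D : GeneralizedDivisor X) (n : ℕ) (x : X) :
    (n • D).stalk x = D.stalk x ^ n := by
  induction n with
  | zero => rw [zero_nsmul, pow_zero, zero_stalk]
  | succ n ih => rw [succ_nsmul, pow_succ, add_stalk, ih]

lemma isEffective_zero : (0 : GeneralizedDivisor X).IsEffective := fun _ => le_rfl

lemma isCartier_zero : (0 : GeneralizedDivisor X).IsCartier := fun x =>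
  ⟨1, by rw [zero_stalk, Units.val_one, Submodule.one_eq_span]⟩

lemma pushforwardFitting_eq (E : GeneralizedDivisor X) (V : Y.Opens) :
    letI := (π.app V).hom.toAlgebra
    pushforwardFitting π E V =
      fittingIdeal Γ(Y, V) (Γ(X, π ⁻¹ᵁ V) ⧸ E.idealSections (π ⁻¹ᵁ V)) := by
  rfl

lemma pushforwardFitting_zero (V : Y.Opens) :
    pushforwardFitting π (0 : GeneralizedDivisor X) V = ⊤ := by
  have h : (0 : GeneralizedDivisor X).idealSections (π ⁻¹ᵁ V) = ⊤ := by
    rw [Ideal.eq_top_iff_one, mem_idealSections]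
    intro x hx
    exact Submodule.mem_one.2 ⟨_, rfl⟩
  let := (π.app V).hom.toAlgebra
  rw [pushforwardFitting_eq, h]
  exact fittingIdeal_eq_top_of_subsingleton _ _

section Stalk

variable [Flat π]

/-- Multiplying 𝓘_D 𝒪_X = 𝓘_E 𝓘_F⁻¹ by `G` and by 𝓘_F clears both denominators, giving an identity
of honest ideals to which Fitting ideals apply. -/
lemma span_stalkMap_mul_idealStalk {D : GeneralizedDivisor Y} {E F : GeneralizedDivisor X}
    (hE : E.IsEffective) (hF : F.IsEffective) (hFc : F.IsCartier)
    (h : (pullback π D).IsDifference E F) (x : X) (G : Y.presheaf.stalk (π x))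
    (J : Ideal (Y.presheaf.stalk (π x)))
    (hJ : IsLocalization.coeSubmodule (TotalQuotient Y (π x)) J =
      Submodule.span _ {algebraMap _ (TotalQuotient Y (π x)) G} * D.stalk (π x)) :
    Ideal.span {(π.stalkMap x).hom G} * E.idealStalk x =
      F.idealStalk x * J.map (π.stalkMap x).hom := by
  have hg := totalQuotientMap_algebraMap π x
  apply IsLocalization.coeSubmodule_injective (TotalQuotient X x) (M := nonZeroDivisors _) le_rfl
  rw [IsLocalization.coeSubmodule_mul, IsLocalization.coeSubmodule_mul,
    hE.coeSubmodule_idealStalk, hF.coeSubmodule_idealStalk,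
    ← Submodule.extendAlong_coeSubmodule hg, hJ, Submodule.extendAlong_mul hg,
    Submodule.extendAlong_span_singleton hg, hg, IsLocalization.coeSubmodule_span_singleton,
    ← pullback_stalk, h x]
  calc _ = Submodule.span _ {algebraMap _ (TotalQuotient X x) ((π.stalkMap x).hom G)} *
        (E.stalk x * (F.stalk x * (1 / F.stalk x))) := by rw [hFc.mul_one_div, mul_one]
    _ = _ := by ring

/-- The core computation: `ν` is the norm of a generator of `F` along the fibre, and it is the only
trace that the decomposition leaves in the Fitting ideal of `E`. -/
lemma exists_coeSubmodule_pushforwardFitting_eq [IsCurve Y] [IsFinite π] (n : ℕ)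
    (hn : ∀ y : Y, π.finrank y = n) {D : GeneralizedDivisor Y} {E F : GeneralizedDivisor X}
    (hE : E.IsEffective) (hF : F.IsEffective) (hFc : F.IsCartier)
    (h : (pullback π D).IsDifference E F) {V : Y.Opens} (hV : IsAffineOpen V) {y : Y} (hy : y ∈ V) :
    ∃ ν ∈ nonZeroDivisors (Y.presheaf.stalk y),
      (pushforwardFitting π F V).map (Y.presheaf.germ V y hy).hom = Ideal.span {ν} ∧
      IsLocalization.coeSubmodule (TotalQuotient Y y)
          ((pushforwardFitting π E V).map (Y.presheaf.germ V y hy).hom) =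
        Submodule.span _ {algebraMap _ (TotalQuotient Y y) ν} * D.stalk y ^ n := by
  have hU := hV.preimage π
  -- a denominator of `D` at `y`
  obtain ⟨G₀, hG₀, hG₀D⟩ := Submodule.exists_nonZeroDivisor_mul_mem_one _ (D.fg_stalk y)
  obtain ⟨g, t, ht, hgt⟩ := hV.exists_germ_mul_eq hy G₀
  have hG : Y.presheaf.germ V y hy g ∈ nonZeroDivisors (Y.presheaf.stalk y) := by
    rw [← hgt]
    exact mul_mem hG₀ ht.mem_nonZeroDivisors
  obtain ⟨J', hJ'⟩ : ∃ J' : Ideal (Y.presheaf.stalk y),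
      IsLocalization.coeSubmodule (TotalQuotient Y y) J' =
        Submodule.span _ {algebraMap _ (TotalQuotient Y y) (Y.presheaf.germ V y hy g)} *
          D.stalk y := by
    let N := Submodule.span (Y.presheaf.stalk y)
      {algebraMap _ (TotalQuotient Y y) (Y.presheaf.germ V y hy g)} * D.stalk y
    have hN : N ≤ 1 := by
      refine Submodule.mul_le.2 fun a ha z hz => ?_
      obtain ⟨r, rfl⟩ := Submodule.mem_span_singleton.1 ha
      rw [← hgt, map_mul, mul_comm (algebraMap _ _ G₀), smul_mul_assoc, mul_assoc,
        ← Algebra.smul_def]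
      exact Submodule.smul_mem _ _ (Submodule.smul_mem _ _ (hG₀D z hz))
    refine ⟨N.comap (Algebra.linearMap _ _), le_antisymm (Submodule.map_comap_le _ _) fun z hz => ?_⟩
    obtain ⟨r, rfl⟩ := Submodule.mem_one.1 (hN hz)
    exact ⟨r, hz, rfl⟩
  obtain ⟨f, hf⟩ := hFc.exists_generator_fiber hF π hV hy
  let := (π.app V).hom.toAlgebra
  let := Y.presheaf.algebra_section_stalk ⟨y, hy⟩
  have := hV.isLocalization_stalk ⟨y, hy⟩
  let J : Ideal Γ(Y, V) := J'.comap (Y.presheaf.germ V y hy).hom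
  have hJ : J.map (Y.presheaf.germ V y hy).hom = J' :=
    IsLocalization.map_under (hV.primeIdealOf ⟨y, hy⟩).asIdeal.primeCompl _ J'
  -- g𝓘_E and fJ have the same stalks along the fibre; by `exists_app_mul_mem` they then agree after
  -- localizing at the prime of `y`.
  have key : ∀ (x : X) (hx : x ∈ π ⁻¹ᵁ V), π x = y →
      (Ideal.span {π.app V g} * E.idealSections (π ⁻¹ᵁ V)).map (X.presheaf.germ _ x hx).hom =
        (Ideal.span {f} * J.map (π.app V).hom).map (X.presheaf.germ _ x hx).hom := by
    intro x hx hxy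
    obtain ⟨-, hfx⟩ := hf x hx hxy
    subst hxy
    have h1 := span_stalkMap_mul_idealStalk π hE hF hFc h x _ J' hJ'
    have h2 : (π.stalkMap x).hom (Y.presheaf.germ V (π x) hy g) =
      X.presheaf.germ (π ⁻¹ᵁ V) x hx (π.app V g) := Scheme.Hom.germ_stalkMap_apply π V x hy g
    rw [h2, hfx] at h1
    rw [Ideal.map_mul, Ideal.map_mul, Ideal.map_span, Ideal.map_span, Set.image_singleton,
      Set.image_singleton, map_germ_idealSections hE hU hx]
    refine h1.trans ?_
    congr 1
    rw [← hJ, Ideal.map_map, Ideal.map_map, ← CommRingCat.hom_comp, ← CommRingCat.hom_comp,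
      Scheme.Hom.germ_stalkMap]
  have hloc : ∀ (b : Γ(X, π ⁻¹ᵁ V)) (I : Ideal Γ(X, π ⁻¹ᵁ V)),
      (∀ (x : X) (hx : x ∈ π ⁻¹ᵁ V), π x = y → X.presheaf.germ _ x hx b ∈
        I.map (X.presheaf.germ _ x hx).hom) →
      ∃ s ∉ (hV.primeIdealOf ⟨y, hy⟩).asIdeal, π.app V s * b ∈ I := fun b I hb => by
    obtain ⟨s, hs, hsb⟩ := hV.exists_app_mul_mem π hy b I hb
    exact ⟨s, (hV.isUnit_germ_iff hy s).1 hs, hsb⟩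
  have hspan : ∀ (x : X) (hx : x ∈ π ⁻¹ᵁ V), π x = y →
      (Ideal.span {f}).map (X.presheaf.germ _ x hx).hom = F.idealStalk x := by
    intro x hx hxy
    rw [(hf x hx hxy).2, Ideal.map_span, Set.image_singleton]
  have : Module.Finite Γ(Y, V) Γ(X, π ⁻¹ᵁ V) := π.finite_app V hV
  have : Module.Flat Γ(Y, V) Γ(X, π ⁻¹ᵁ V) := by
    have hflat := π.flat_appLE hV hU le_rfl
    rwa [Scheme.Hom.appLE_eq_app] at hflat
  have : IsNoetherianRing Γ(Y, V) := IsLocallyNoetherian.component_noetherian ⟨V, hV⟩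
  obtain ⟨ν, hν, hνF, hνE⟩ := exists_span_pow_mul_fittingIdeal_map_eq
    (hV.primeIdealOf ⟨y, hy⟩) n ((hV.rankAtStalk_app π hy).trans (hn y)) (Y.presheaf.stalk y) g f
    (E.idealSections (π ⁻¹ᵁ V)) (F.idealSections (π ⁻¹ᵁ V)) J
    (fun b hb => hloc b _ fun x hx hxy => by
      rw [hspan x hx hxy]
      exact mem_idealSections.1 hb x hx)
    (hloc f _ fun x hx hxy => by
      rw [map_germ_idealSections hF hU hx, (hf x hx hxy).2]
      exact Ideal.mem_span_singleton_self _)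
    (fun b hb => hloc b ⊥ fun x hx hxy => by
      have h1 := congrArg (X.presheaf.germ _ x hx) hb
      rw [map_mul, map_zero] at h1
      rw [(mem_nonZeroDivisors_iff_right.1 (hf x hx hxy).1 _ h1)]
      exact zero_mem _)
    (fun b hb => hloc b _ fun x hx hxy => (key x hx hxy).le (Ideal.mem_map_of_mem _ hb))
    (fun b hb => hloc b _ fun x hx hxy => (key x hx hxy).ge (Ideal.mem_map_of_mem _ hb))
  refine ⟨ν, hν, ?_, ?_⟩
  · rw [pushforwardFitting_eq]
    exact hνF
  · have h1 : Ideal.span {Y.presheaf.germ V y hy g ^ n} *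
        (pushforwardFitting π E V).map (Y.presheaf.germ V y hy).hom =
        Ideal.span {ν} * J' ^ n := by
      rw [← hJ]
      exact hνE
    -- As `J'` is `g` times the stalk of `D`, both sides carry the factor `g ^ n`; it is invertible
    -- in the total quotient ring and cancels.
    have h4 := congrArg (IsLocalization.coeSubmodule (TotalQuotient Y y)) h1
    have hu := isUnit_algebraMap_of_mem_nonZeroDivisors (pow_mem hG n)
    have h3 := Submodule.span_singleton_units_mul_one_div (R := Y.presheaf.stalk y) hu.unit
    rw [hu.unit_spec] at h3
    rw [IsLocalization.coeSubmodule_mul, IsLocalization.coeSubmodule_mul,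
      IsLocalization.coeSubmodule_pow, IsLocalization.coeSubmodule_span_singleton,
      IsLocalization.coeSubmodule_span_singleton, hJ', mul_pow, Submodule.span_pow,
      Set.singleton_pow, ← map_pow (algebraMap _ (TotalQuotient Y y))] at h4
    generalize Submodule.span (Y.presheaf.stalk y)
      {algebraMap _ (TotalQuotient Y y) (Y.presheaf.germ V y hy g ^ n)} = P at h4 h3
    calc _ = (P * (1 / P)) * IsLocalization.coeSubmodule (TotalQuotient Y y)
          ((pushforwardFitting π E V).map (Y.presheaf.germ V y hy).hom) := by rw [h3, one_mul]
      _ = (P * IsLocalization.coeSubmodule (TotalQuotient Y y)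
          ((pushforwardFitting π E V).map (Y.presheaf.germ V y hy).hom)) * (1 / P) := by ring
      _ = (P * (1 / P)) * (Submodule.span _ {algebraMap _ (TotalQuotient Y y) ν} *
          D.stalk y ^ n) := by rw [h4]; ring
      _ = _ := by rw [h3, one_mul]

/-- The case `F = 0`: the quotient by the unit ideal has Fitting ideal `⊤`, so `ν` is a unit. -/
lemma isEffectiveDirectImage_pullback [IsCurve Y] [IsFinite π] (n : ℕ)
    (hn : ∀ y : Y, π.finrank y = n) {E : GeneralizedDivisor Y} (hE : E.IsEffective) :
    IsEffectiveDirectImage π (pullback π E) (n • E) := by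
  intro V hV y hy
  have h0 := (isCartier_zero (X := X)).isDifference_add (pullback π E)
  rw [add_zero] at h0
  obtain ⟨ν, hν, h1, h2⟩ := exists_coeSubmodule_pushforwardFitting_eq π n hn (hE.pullback π)
    isEffective_zero isCartier_zero h0 hV hy
  rw [pushforwardFitting_zero, Ideal.map_top, eq_comm, Ideal.span_singleton_eq_top] at h1
  rw [h2, span_algebraMap_eq_one_of_isUnit h1, one_mul, nsmul_stalk]

theorem isDirectImage_pullback_iff [IsCurve Y] [IsFinite π] (n : ℕ)
    (hn : ∀ y : Y, π.finrank y = n) (D D₂ : GeneralizedDivisor Y) :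
    IsDirectImage π (pullback π D) D₂ ↔ D₂ = n • D := by
  constructor
  · rintro ⟨E, F, hE, hF, hFc, hD, E', F', hE', hF', hD₂⟩
    ext y : 2
    obtain ⟨V, hV, hyV, -⟩ := exists_isAffineOpen_mem_and_subset (U := ⊤) (x := y) trivial
    obtain ⟨ν, hν, h1, h2⟩ :=
      exists_coeSubmodule_pushforwardFitting_eq π n hn hE hF hFc hD hV hyV
    have hu := isUnit_algebraMap_of_mem_nonZeroDivisors hν
    have h3 := Submodule.span_singleton_units_mul_one_div (R := Y.presheaf.stalk y) hu.unit
    rw [hu.unit_spec] at h3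
    rw [hD₂ y, hE' V hV y hyV, hF' V hV y hyV, h1, h2, IsLocalization.coeSubmodule_span_singleton,
      nsmul_stalk, mul_right_comm, h3, one_mul]
  · rintro rfl
    -- For existence the decomposition is taken on `Y` and pulled back, since then both direct
    -- images are known to be divisors, namely multiples by `n`.
    obtain ⟨F, hF, hFc, hE⟩ := exists_isCartier_add_isEffective D
    have hdiff := hFc.isDifference_add D
    refine ⟨pullback π (D + F), pullback π F, hE.pullback π, hF.pullback π, hFc.pullback π,
      hdiff.pullback π hFc, n • (D + F), n • F, isEffectiveDirectImage_pullback π n hn hE,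
      isEffectiveDirectImage_pullback π n hn hF, ?_⟩
    have hFn : (n • F).IsCartier := fun y => by
      obtain ⟨f, hf⟩ := hFc y
      exact ⟨f ^ n, by
        rw [nsmul_stalk, hf, Submodule.span_pow, Set.singleton_pow, Units.val_pow_eq_pow_val]⟩
    rw [nsmul_add]
    exact hFn.isDifference_add _

end Stalk

end GeneralizedDivisor

/-- For a finite flat morphism `π : X ⟶ Y` of degree `n` between curves and a generalized divisor
`D` on `Y`: the inverse image `π^*(D)` is well defined (it is `D₁`), its direct image is well
defined, and `π_*(π^*(D)) = n • D`. -/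
theorem proposition5p18 {X Y : Scheme.{u}} [IsCurve X] [IsCurve Y] (π : X ⟶ Y) [IsFinite π]
    [Flat π] (n : ℕ) (hn : ∀ y : Y, π.finrank y = n) (D : GeneralizedDivisor Y) :
    ∃ D₁ : GeneralizedDivisor X,
      (∀ D' : GeneralizedDivisor X, GeneralizedDivisor.IsInverseImage π D D' ↔ D' = D₁) ∧
      ∀ D₂ : GeneralizedDivisor Y, GeneralizedDivisor.IsDirectImage π D₁ D₂ ↔ D₂ = n • D :=
  ⟨GeneralizedDivisor.pullback π D, GeneralizedDivisor.isInverseImage_iff π D,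
    GeneralizedDivisor.isDirectImage_pullback_iff π n hn D⟩
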